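/- Let $d\ge 1$ and let $\phi_0$ be a probability density on $\mathbb R^d$ (that is, $\phi_0\ge 0$, $\phi_0\in L^1(\mathbb R^d)$, $\int\phi_0\,dx=1$). For $t>0$ let $\phi_t=\phi_0*p_t$, where $p_t(x)=(4\pi t)^{-d/2}e^{-|x|^2/(4t)}$ is the heat kernel. For a probability density $\rho$ put $$S_q(\rho)=\frac{1-\int_{\mathbb R^d}\rho^q\,dx}{q-1}\quad(q>1),\qquad S_1(\rho)=-\int_{\mathbb R^d}\rho\log\rho\,dx .$$ Let $q\in[1,3]$ if $d=1$, and $q\in\big[1,\tfrac{2(\sqrt5+1)}{\sqrt5}\big]$ (where $\tfrac{2(\sqrt5+1)}{\sqrt5}\approx 2.894$) if $d>1$. Then $S_q(\phi_t)$ is finite for every $t>0$, the function $t\mapsto S_q(\phi_t)$ is concave and twice differentiable on $(0,\infty)$, and $$\frac{d^2}{dt^2}S_q(\phi_t)\le 0\qquad\text{for all } t>0,$$ with the only exception that for $q=1$ it may happen that $S_1(\phi_t)=+\infty$ for every $t>0$. -/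

import Mathlib

open MeasureTheory Set

noncomputable section

/-- `ρ` is a probability density on `ℝ^d` with respect to Lebesgue measure. -/
structure IsProbDensity {d : ℕ} (ρ : EuclideanSpace ℝ (Fin d) → ℝ) : Prop where
  nonneg : ∀ᵐ x, 0 ≤ ρ x
  integrable : Integrable ρ
  integral_eq_one : ∫ x, ρ x = 1

/-- The Gaussian heat kernel `p_t(x) = (4πt)^(-d/2) exp(-|x|²/(4t))` on `ℝ^d`, used for `t > 0`. -/
def heatKernel (d : ℕ) (t : ℝ) (x : EuclideanSpace ℝ (Fin d)) : ℝ :=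
  (4 * Real.pi * t) ^ (-(d : ℝ) / 2) * Real.exp (-‖x‖ ^ 2 / (4 * t))

/-- The heat flow `φ_t = φ₀ * p_t`, used for `t > 0`. -/
def heatFlow {d : ℕ} (φ₀ : EuclideanSpace ℝ (Fin d) → ℝ) (t : ℝ) :
    EuclideanSpace ℝ (Fin d) → ℝ :=
  convolution φ₀ (heatKernel d t) (ContinuousLinearMap.mul ℝ ℝ) volume

/-- The Tsallis entropy `S_q(ρ) = (1 - ∫ ρ^q) / (q - 1)` for `q ≠ 1`; for `q = 1` it is the
Shannon entropy `-∫ ρ log ρ`. The value is meaningful when `TsallisFinite q ρ` holds. -/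
def tsallisEntropy {d : ℕ} (q : ℝ) (ρ : EuclideanSpace ℝ (Fin d) → ℝ) : ℝ :=
  if q = 1 then -∫ x, ρ x * Real.log (ρ x) else (1 - ∫ x, ρ x ^ q) / (q - 1)

/-- The integral that defines `S_q(ρ)` converges absolutely, i.e. `S_q(ρ)` is finite. -/
def TsallisFinite {d : ℕ} (q : ℝ) (ρ : EuclideanSpace ℝ (Fin d) → ℝ) : Prop :=
  if q = 1 then Integrable (fun x => ρ x * Real.log (ρ x)) else Integrable (fun x => ρ x ^ q)

/-- The Shannon entropy `-∫ ρ log ρ` is well defined in `[-∞, ∞]` and equals `+∞`: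
the positive part of `-ρ log ρ` has infinite integral, the negative part a finite one. -/
def ShannonEntropyEqTop {d : ℕ} (ρ : EuclideanSpace ℝ (Fin d) → ℝ) : Prop :=
  ∫⁻ x, ENNReal.ofReal (-(ρ x * Real.log (ρ x))) = ⊤ ∧
    ∫⁻ x, ENNReal.ofReal (ρ x * Real.log (ρ x)) < ⊤

end

/-!
Differentiating twice along the heat flow `u` gives `d/dt S_q(u) = q ∫ u ^ q |∇ log u|²` and, for
the derivative of this Fisher information, an integral with third derivatives of `u`. Adding
multiples of `∫ div(u ^ q Tr(H) g) = 0`, `∫ div(u ^ q H g) = 0` and `∫ div(u ^ q |g|² g) = 0`, where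
`g = ∇u / u` and `H = D²u / u`, removes the third derivatives and leaves `-∫ u ^ q Q(g ⊗ g, H)` for
a quadratic form `Q`. In the admissible range of `q` the multiples can be chosen such that `Q` is a
sum of squares.

All derivatives of `u` have the form `∫ P(x - y, 1 / t) p_t(x - y) dμ(y)` with a polynomial `P`, and
`u |∂u / u| ^ n ≤ ∫ |P| ^ n p_t dμ` by Jensen's inequality. This yields integrable majorants that
are locally uniform in `t` and `q`, which justify every differentiation and integration by parts.

For `q = 1` the entropy may be infinite. There `S_q(u_t) - S_q(u_s) = ∫ τ in s..t, q I_q(τ)`, with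
the Fisher information `I_q`, is passed to the limit `q → 1`, so finiteness at one time implies
finiteness at all times together with the formula for the derivative.
-/

open Filter Topology MvPolynomial

noncomputable section

/-- Polynomials in the coordinates (`some i`) and in the inverse time `1 / t` (`none`). The
derivatives of the heat kernel are multiples of the kernel by such polynomials. -/
abbrev HeatPoly (d : ℕ) := MvPolynomial (Option (Fin d)) ℝ

namespace HeatPoly

variable {d : ℕ}

/-- The operator that `∂ᵢ` induces on the polynomial factor of `P p_t`. -/
def spaceDeriv (i : Fin d) (P : HeatPoly d) : HeatPoly d :=
  pderiv (some i) P - C (1 / 2) * X none * X (some i) * P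

/-- The operator that `∂ₜ` induces on the polynomial factor of `P p_t`. -/
def timeDeriv (P : HeatPoly d) : HeatPoly d :=
  -X none ^ 2 * pderiv none P +
    (C (1 / 4) * X none ^ 2 * ∑ j : Fin d, X (some j) ^ 2 - C (d / 2 : ℝ) * X none) * P

lemma pderiv_comm {σ R : Type*} [CommRing R] (i j : σ) (P : MvPolynomial σ R) :
    pderiv i (pderiv j P) = pderiv j (pderiv i P) := by
  classical
  have h : ⁅pderiv (R := R) i, pderiv j⁆ = 0 := derivation_ext fun k => by
    rw [Derivation.commutator_apply]
    simp [pderiv_X, Pi.single_apply, apply_ite]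
  simpa [Derivation.commutator_apply, sub_eq_zero] using congrArg (fun D => D P) h

lemma spaceDeriv_comm (i j : Fin d) (P : HeatPoly d) :
    spaceDeriv i (spaceDeriv j P) = spaceDeriv j (spaceDeriv i P) := by
  rcases eq_or_ne i j with rfl | hij
  · rfl
  have h : pderiv (some i) (X (some j) : HeatPoly d) = 0 := pderiv_X_of_ne (by simpa using hij.symm)
  have h' : pderiv (some j) (X (some i) : HeatPoly d) = 0 := pderiv_X_of_ne (by simpa using hij)
  simp [spaceDeriv, h, h', pderiv_comm (some i) (some j)]
  ring

lemma spaceDeriv_sum (i : Fin d) {ι : Type*} (s : Finset ι) (P : ι → HeatPoly d) :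
    spaceDeriv i (∑ k ∈ s, P k) = ∑ k ∈ s, spaceDeriv i (P k) := by
  simp only [spaceDeriv, map_sum, Finset.mul_sum, Finset.sum_sub_distrib]

lemma timeDeriv_spaceDeriv (i : Fin d) (P : HeatPoly d) :
    timeDeriv (spaceDeriv i P) = spaceDeriv i (timeDeriv P) := by
  have hsum : pderiv (some i) (∑ j : Fin d, X (some j) ^ 2 : HeatPoly d) = 2 * X (some i) := by
    classical
    simp [pderiv_X, Pi.single_apply]
  have hC : (C (1 / 2) : HeatPoly d) = C (1 / 4) + C (1 / 4) := by rw [← C_add]; norm_num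
  simp only [spaceDeriv, timeDeriv, map_sub, map_add, pderiv_mul, pderiv_pow, pderiv_C, hsum,
    map_neg, pderiv_X_of_ne (R := ℝ) (Option.some_ne_none i),
    pderiv_X_of_ne (R := ℝ) (Option.some_ne_none i).symm, pderiv_X_self,
    pderiv_comm (some i) none, hC]
  ring

lemma timeDeriv_one : timeDeriv (1 : HeatPoly d) = ∑ j, spaceDeriv j (spaceDeriv j 1) := by
  have h (j : Fin d) : spaceDeriv j (spaceDeriv j 1) =
      C (1 / 4) * X none ^ 2 * X (some j) ^ 2 - C (1 / 2) * X none := by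
    have hC : (C (1 / 4) : HeatPoly d) = C (1 / 2) * C (1 / 2) := by rw [← C_mul]; norm_num
    rw [hC]
    simp [spaceDeriv]
    ring
  have hC : (C (d / 2 : ℝ) : HeatPoly d) = (d : HeatPoly d) * C (1 / 2) := by
    rw [← map_natCast (C (σ := Option (Fin d)) (R := ℝ)) d, ← C_mul]; ring_nf
  simp only [h, Finset.sum_sub_distrib, ← Finset.mul_sum]
  rw [timeDeriv, hC]
  simp
  ring

lemma sum_spaceDeriv_spaceDeriv_spaceDeriv_one (i : Fin d) :
    ∑ j, spaceDeriv j (spaceDeriv j (spaceDeriv i (1 : HeatPoly d))) =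
      timeDeriv (spaceDeriv i 1) := by
  simp only [timeDeriv_spaceDeriv, timeDeriv_one, spaceDeriv_sum]
  simp only [spaceDeriv_comm _ i]

/-- The values of the variables of a `HeatPoly` at the point `z` and the time `t`. -/
def point (t : ℝ) (z : EuclideanSpace ℝ (Fin d)) : Option (Fin d) → ℝ
  | none => t⁻¹
  | some i => z i

@[simp] lemma point_none (t : ℝ) (z : EuclideanSpace ℝ (Fin d)) : point t z none = t⁻¹ := rfl

@[simp] lemma point_some (t : ℝ) (z : EuclideanSpace ℝ (Fin d)) (i : Fin d) :
    point t z (some i) = z i := rfl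

end HeatPoly

lemma hasDerivAt_mvPolynomial_eval {σ : Type*} [Fintype σ] {γ : ℝ → σ → ℝ} {γ' : σ → ℝ} {s : ℝ}
    (hγ : ∀ k, HasDerivAt (fun s => γ s k) (γ' k) s) (P : MvPolynomial σ ℝ) :
    HasDerivAt (fun s => eval (γ s) P) (∑ k, γ' k * eval (γ s) (pderiv k P)) s := by
  induction P using MvPolynomial.induction_on with
  | C c => simpa using hasDerivAt_const s c
  | add P Q hP hQ => simpa [mul_add, Finset.sum_add_distrib] using HasDerivAt.fun_add hP hQ
  | mul_X P k hP =>
    classical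
    simp only [eval_mul, eval_X]
    refine (hP.mul (hγ k)).congr_deriv ?_
    simp [pderiv_X, Pi.single_apply, mul_add, Finset.sum_add_distrib, Finset.sum_mul]
    simp only [apply_ite (eval (γ s)), map_zero]
    simp [mul_comm, mul_left_comm, add_comm]

section PolyKernel

open HeatPoly

variable {d : ℕ}

/-- The multiple `P(z, 1 / t) p_t(z)` of the heat kernel. -/
def polyKernel (P : HeatPoly d) (t : ℝ) (z : EuclideanSpace ℝ (Fin d)) : ℝ :=
  eval (point t z) P * heatKernel d t z

@[simp] lemma polyKernel_one (t : ℝ) : polyKernel 1 t = heatKernel d t := by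
  ext z
  simp [polyKernel]

lemma heatKernel_pos {t : ℝ} (ht : 0 < t) (z : EuclideanSpace ℝ (Fin d)) :
    0 < heatKernel d t z := by
  unfold heatKernel
  positivity

lemma continuous_polyKernel (P : HeatPoly d) (t : ℝ) : Continuous (polyKernel P t) := by
  have h : Continuous (point t : EuclideanSpace ℝ (Fin d) → _) := by
    refine continuous_pi fun k => ?_
    cases k <;> simp only [point_none, point_some] <;> fun_prop
  unfold polyKernel heatKernel
  exact ((continuous_eval P).comp h).mul (by fun_prop)

lemma hasDerivAt_polyKernel_line (P : HeatPoly d) (i : Fin d) (t : ℝ)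
    (z : EuclideanSpace ℝ (Fin d)) (s : ℝ) :
    HasDerivAt (fun s : ℝ => polyKernel P t (z + s • EuclideanSpace.single i (1 : ℝ)))
      (polyKernel (spaceDeriv i P) t (z + s • EuclideanSpace.single i (1 : ℝ))) s := by
  have hline : HasDerivAt (fun s : ℝ => z + s • EuclideanSpace.single i (1 : ℝ))
      (EuclideanSpace.single i (1 : ℝ)) s := by
    simpa using ((hasDerivAt_id s).smul_const (EuclideanSpace.single i (1 : ℝ))).const_add z
  have hpoint (k : Option (Fin d)) : HasDerivAt
      (fun s : ℝ => point t (z + s • EuclideanSpace.single i (1 : ℝ)) k)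
      (if k = some i then 1 else 0) s := by
    cases k with
    | none => simpa using hasDerivAt_const s t⁻¹
    | some j =>
      have := (hasDerivAt_id s).mul_const ((EuclideanSpace.single i (1 : ℝ)) j)
      simpa [Pi.single_apply] using this.const_add (z j)
  have hexp := ((hline.norm_sq.neg.div_const (4 * t)).exp).const_mul
    ((4 * Real.pi * t) ^ (-(d : ℝ) / 2))
  refine ((hasDerivAt_mvPolynomial_eval hpoint P).mul hexp).congr_deriv ?_
  simp [polyKernel, spaceDeriv, heatKernel, EuclideanSpace.inner_single_right]
  ring

lemma hasDerivAt_heatKernel {t : ℝ} (ht : 0 < t) (z : EuclideanSpace ℝ (Fin d)) :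
    HasDerivAt (fun t => heatKernel d t z)
      ((‖z‖ ^ 2 / (4 * t ^ 2) - d / (2 * t)) * heatKernel d t z) t := by
  have hpos : 0 < 4 * Real.pi * t := by positivity
  have hpow := ((hasDerivAt_id t).const_mul (4 * Real.pi)).rpow_const (p := -(d : ℝ) / 2)
    (Or.inl hpos.ne')
  have hexp := ((hasDerivAt_const t (-‖z‖ ^ 2)).div ((hasDerivAt_id t).const_mul 4)
    (by simpa using ht.ne')).exp
  refine (hpow.mul hexp).congr_deriv ?_
  simp only [heatKernel, id, Real.rpow_sub_one hpos.ne']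
  simp
  field_simp
  ring

lemma hasDerivAt_polyKernel (P : HeatPoly d) {t : ℝ} (ht : 0 < t)
    (z : EuclideanSpace ℝ (Fin d)) :
    HasDerivAt (fun t => polyKernel P t z) (polyKernel (timeDeriv P) t z) t := by
  have hpoint (k : Option (Fin d)) : HasDerivAt (fun t : ℝ => point t z k)
      (if k = none then -(t ^ 2)⁻¹ else 0) t := by
    cases k with
    | none => simpa using hasDerivAt_inv ht.ne'
    | some j => simpa using hasDerivAt_const t (z j)
  refine ((hasDerivAt_mvPolynomial_eval hpoint P).mul (hasDerivAt_heatKernel ht z)).congr_deriv ?_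
  simp [polyKernel, timeDeriv, EuclideanSpace.real_norm_sq_eq]
  field_simp

end PolyKernel

section GaussianBound

open HeatPoly

variable {d : ℕ}

lemma le_mul_exp_mul_sq {δ : ℝ} (hδ : 0 < δ) (x : ℝ) :
    x ≤ (1 + δ⁻¹) * Real.exp (δ * x ^ 2) := by
  have hexp : δ * x ^ 2 + 1 ≤ Real.exp (δ * x ^ 2) := Real.add_one_le_exp _
  calc x ≤ 1 + δ⁻¹ * (δ * x ^ 2) := by field_simp; nlinarith [sq_nonneg (x - 1)]
    _ ≤ Real.exp (δ * x ^ 2) + δ⁻¹ * Real.exp (δ * x ^ 2) := by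
      gcongr
      · nlinarith [sq_nonneg x]
      · linarith
    _ = (1 + δ⁻¹) * Real.exp (δ * x ^ 2) := by ring

lemma exists_abs_point_le {a δ : ℝ} (ha : 0 < a) (hδ : 0 < δ) (k : Option (Fin d)) :
    ∃ C, ∀ t ≥ a, ∀ z : EuclideanSpace ℝ (Fin d),
      |point t z k| ≤ C * Real.exp (δ * ‖z‖ ^ 2) := by
  cases k with
  | none =>
    refine ⟨a⁻¹, fun t hat z => ?_⟩
    have ht : 0 < t := ha.trans_le hat
    rw [point_none, abs_of_pos (inv_pos.2 ht)]
    calc t⁻¹ ≤ a⁻¹ * 1 := by rw [mul_one]; gcongr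
      _ ≤ a⁻¹ * Real.exp (δ * ‖z‖ ^ 2) := by
        gcongr
        exact Real.one_le_exp (by positivity)
  | some i =>
    exact ⟨1 + δ⁻¹, fun t _ z => (PiLp.norm_apply_le z i).trans (le_mul_exp_mul_sq hδ _)⟩

lemma exists_abs_eval_point_le (P : HeatPoly d) {a ε : ℝ} (ha : 0 < a) (hε : 0 < ε) :
    ∃ C, ∀ t ≥ a, ∀ z, |eval (point t z) P| ≤ C * Real.exp (ε * ‖z‖ ^ 2) := by
  induction P using MvPolynomial.induction_on generalizing ε with
  | C c =>
    refine ⟨|c|, fun t _ z => ?_⟩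
    rw [eval_C]
    exact le_mul_of_one_le_right (abs_nonneg c) (Real.one_le_exp (by positivity))
  | add P Q hP hQ =>
    obtain ⟨C, hC⟩ := hP hε
    obtain ⟨C', hC'⟩ := hQ hε
    refine ⟨C + C', fun t ht z => ?_⟩
    rw [map_add, add_mul]
    exact (abs_add_le _ _).trans (add_le_add (hC t ht z) (hC' t ht z))
  | mul_X P k hP =>
    obtain ⟨C, hC⟩ := hP (half_pos hε)
    obtain ⟨C', hC'⟩ := exists_abs_point_le (d := d) ha (half_pos hε) k
    refine ⟨C * C', fun t ht z => ?_⟩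
    calc |eval (point t z) (P * X k)| = |eval (point t z) P| * |point t z k| := by
          rw [eval_mul, eval_X, abs_mul]
      _ ≤ C * Real.exp (ε / 2 * ‖z‖ ^ 2) * (C' * Real.exp (ε / 2 * ‖z‖ ^ 2)) :=
          mul_le_mul (hC t ht z) (hC' t ht z) (abs_nonneg _) ((abs_nonneg _).trans (hC t ht z))
      _ = C * C' * Real.exp (ε * ‖z‖ ^ 2) := by
          rw [mul_mul_mul_comm, ← Real.exp_add]; ring_nf

lemma heatKernel_le_mul_exp {a b t : ℝ} (ha : 0 < a) (ht : t ∈ Icc a b)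
    (z : EuclideanSpace ℝ (Fin d)) :
    heatKernel d t z ≤ (4 * Real.pi * a) ^ (-(d : ℝ) / 2) * Real.exp (-‖z‖ ^ 2 / (4 * b)) := by
  have htpos : 0 < t := ha.trans_le ht.1
  unfold heatKernel
  gcongr ?_ * ?_
  · exact Real.rpow_le_rpow_of_nonpos (by positivity) (by gcongr; exact ht.1)
      (div_nonpos_of_nonpos_of_nonneg (neg_nonpos.2 d.cast_nonneg) zero_le_two)
  · rw [Real.exp_le_exp, neg_div, neg_div, neg_le_neg_iff]
    gcongr
    exact ht.2

lemma exists_abs_polyKernel_le (P : HeatPoly d) {a b : ℝ} (ha : 0 < a) (hab : a ≤ b) :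
    ∃ C, ∀ t ∈ Icc a b, ∀ z, |polyKernel P t z| ≤ C * Real.exp (-(8 * b)⁻¹ * ‖z‖ ^ 2) := by
  have hb : 0 < b := ha.trans_le hab
  obtain ⟨C, hC⟩ := exists_abs_eval_point_le P ha (ε := (8 * b)⁻¹) (by positivity)
  refine ⟨C * (4 * Real.pi * a) ^ (-(d : ℝ) / 2), fun t ht z => ?_⟩
  calc |polyKernel P t z| = |eval (point t z) P| * heatKernel d t z := by
        rw [polyKernel, abs_mul, abs_of_pos (heatKernel_pos (ha.trans_le ht.1) z)]
    _ ≤ C * Real.exp ((8 * b)⁻¹ * ‖z‖ ^ 2) *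
        ((4 * Real.pi * a) ^ (-(d : ℝ) / 2) * Real.exp (-‖z‖ ^ 2 / (4 * b))) :=
        mul_le_mul (hC t ht.1 z) (heatKernel_le_mul_exp ha ht z)
          (heatKernel_pos (ha.trans_le ht.1) z).le ((abs_nonneg _).trans (hC t ht.1 z))
    _ = C * (4 * Real.pi * a) ^ (-(d : ℝ) / 2) * Real.exp (-(8 * b)⁻¹ * ‖z‖ ^ 2) := by
        rw [mul_mul_mul_comm, ← Real.exp_add]
        congr 2
        field_simp
        ring

lemma exists_abs_polyKernel_le_const (P : HeatPoly d) {a b : ℝ} (ha : 0 < a) (hab : a ≤ b) :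
    ∃ C, ∀ t ∈ Icc a b, ∀ z, |polyKernel P t z| ≤ C := by
  obtain ⟨C, hC⟩ := exists_abs_polyKernel_le P ha hab
  have hb : 0 < b := ha.trans_le hab
  have hCpos : 0 ≤ C := by
    simpa using (abs_nonneg _).trans (hC a (left_mem_Icc.2 hab) 0)
  refine ⟨C, fun t ht z => (hC t ht z).trans (mul_le_of_le_one_right hCpos ?_)⟩
  rw [Real.exp_le_one_iff, neg_mul, neg_nonpos]
  positivity

lemma integrable_exp_neg_mul_norm_sq {c : ℝ} (hc : 0 < c) :
    Integrable (fun z : EuclideanSpace ℝ (Fin d) => Real.exp (-c * ‖z‖ ^ 2)) := by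
  have h := GaussianFourier.integrable_cexp_neg_mul_sq_norm_add (b := (c : ℂ)) (by simpa using hc)
    0 (0 : EuclideanSpace ℝ (Fin d))
  refine h.re.congr (ae_of_all _ fun z => ?_)
  have hcast : -(c : ℂ) * (‖z‖ : ℂ) ^ 2 = ((-c * ‖z‖ ^ 2 : ℝ) : ℂ) := by push_cast; ring
  simp only [zero_mul, add_zero, hcast]
  exact Complex.exp_ofReal_re _

lemma integrable_polyKernel (P : HeatPoly d) {t : ℝ} (ht : 0 < t) :
    Integrable (polyKernel P t) := by
  obtain ⟨C, hC⟩ := exists_abs_polyKernel_le P ht le_rfl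
  refine ((integrable_exp_neg_mul_norm_sq (by positivity : 0 < (8 * t)⁻¹)).const_mul C).mono'
    (continuous_polyKernel P t).aestronglyMeasurable (ae_of_all _ fun z => ?_)
  simpa using hC t (by simp) z

lemma integral_heatKernel {t : ℝ} (ht : 0 < t) : ∫ z, heatKernel d t z = 1 := by
  have h (z : EuclideanSpace ℝ (Fin d)) : heatKernel d t z =
      (4 * Real.pi * t) ^ (-(d : ℝ) / 2) * Real.exp (-(4 * t)⁻¹ * ‖z‖ ^ 2) := by
    rw [heatKernel, neg_mul, neg_div (4 * t), div_eq_inv_mul _ (4 * t)]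
  have hpi : Real.pi / (4 * t)⁻¹ = 4 * Real.pi * t := by field_simp
  simp only [h, integral_const_mul]
  rw [GaussianFourier.integral_rexp_neg_mul_sq_norm (by positivity), hpi,
    finrank_euclideanSpace_fin, ← Real.rpow_add (by positivity)]
  simp [neg_div]

end GaussianBound

section PolyFlow

open HeatPoly

variable {d : ℕ}

/-- The heat flow `μ * p_t` with a measure `μ` as initial datum. -/
def measureHeatFlow (μ : Measure (EuclideanSpace ℝ (Fin d))) (t : ℝ)
    (x : EuclideanSpace ℝ (Fin d)) : ℝ :=
  ∫ y, heatKernel d t (x - y) ∂μ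

/-- The convolution of `P p_t` with `μ`; all derivatives of the heat flow of `μ` are of this
form. -/
def polyFlow (μ : Measure (EuclideanSpace ℝ (Fin d))) (P : HeatPoly d) (t : ℝ)
    (x : EuclideanSpace ℝ (Fin d)) : ℝ :=
  ∫ y, polyKernel P t (x - y) ∂μ

variable (μ : Measure (EuclideanSpace ℝ (Fin d)))

lemma polyFlow_one : polyFlow μ 1 = measureHeatFlow μ := by
  ext t x
  simp only [polyFlow, polyKernel_one, measureHeatFlow]

lemma continuous_polyKernel_sub (P : HeatPoly d) (t : ℝ) (x : EuclideanSpace ℝ (Fin d)) :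
    Continuous fun y => polyKernel P t (x - y) :=
  (continuous_polyKernel P t).comp (continuous_sub_left x)

lemma integrable_integral_sub [IsFiniteMeasure μ] {g : EuclideanSpace ℝ (Fin d) → ℝ}
    (hg : Integrable g) : Integrable fun x => ∫ y, g (x - y) ∂μ := by
  simpa using ((integrable_const (μ := μ) (1 : ℝ)).convolution_integrand
    (ContinuousLinearMap.mul ℝ ℝ) hg).integral_prod_left

lemma integral_integral_sub [IsFiniteMeasure μ] {g : EuclideanSpace ℝ (Fin d) → ℝ}
    (hg : Integrable g) : ∫ x, ∫ y, g (x - y) ∂μ = μ.real univ * ∫ x, g x := by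
  simpa [convolution_def] using integral_convolution (ContinuousLinearMap.mul ℝ ℝ)
    (integrable_const (μ := μ) (1 : ℝ)) hg

variable [IsFiniteMeasure μ]

lemma integrable_polyKernel_sub (P : HeatPoly d) {t : ℝ} (ht : 0 < t)
    (x : EuclideanSpace ℝ (Fin d)) : Integrable (fun y => polyKernel P t (x - y)) μ := by
  obtain ⟨C, hC⟩ := exists_abs_polyKernel_le_const P ht le_rfl
  exact .of_bound (continuous_polyKernel_sub P t x).aestronglyMeasurable C
    (ae_of_all _ fun y => hC t (by simp) _)

lemma polyFlow_sum {ι : Type*} (s : Finset ι) (P : ι → HeatPoly d) {t : ℝ} (ht : 0 < t)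
    (x : EuclideanSpace ℝ (Fin d)) :
    polyFlow μ (∑ k ∈ s, P k) t x = ∑ k ∈ s, polyFlow μ (P k) t x := by
  simp only [polyFlow, polyKernel, map_sum, Finset.sum_mul]
  exact integral_finsetSum s fun k _ => integrable_polyKernel_sub μ (P k) ht x

lemma continuous_polyFlow (P : HeatPoly d) {t : ℝ} (ht : 0 < t) :
    Continuous (polyFlow μ P t) := by
  obtain ⟨C, hC⟩ := exists_abs_polyKernel_le_const P ht le_rfl
  exact continuous_of_dominated (bound := fun _ => C)
    (fun x => (continuous_polyKernel_sub P t x).aestronglyMeasurable)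
    (fun x => ae_of_all _ fun y => hC t (by simp) _) (integrable_const C)
    (ae_of_all _ fun y => (continuous_polyKernel P t).comp (continuous_sub_right y))

lemma hasLineDerivAt_polyFlow (P : HeatPoly d) (i : Fin d) {t : ℝ} (ht : 0 < t)
    (x : EuclideanSpace ℝ (Fin d)) :
    HasLineDerivAt ℝ (polyFlow μ P t) (polyFlow μ (spaceDeriv i P) t x) x
      (EuclideanSpace.single i (1 : ℝ)) := by
  obtain ⟨C, hC⟩ := exists_abs_polyKernel_le_const (spaceDeriv i P) ht le_rfl
  have h := (hasDerivAt_integral_of_dominated_loc_of_deriv_le (μ := μ) (bound := fun _ => C)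
    (F := fun (s : ℝ) y => polyKernel P t (x + s • EuclideanSpace.single i (1 : ℝ) - y))
    (F' := fun (s : ℝ) y =>
      polyKernel (spaceDeriv i P) t (x + s • EuclideanSpace.single i (1 : ℝ) - y))
    (x₀ := 0) univ_mem
    (.of_forall fun s => (continuous_polyKernel_sub P t _).aestronglyMeasurable)
    (integrable_polyKernel_sub μ P ht _)
    (continuous_polyKernel_sub _ t _).aestronglyMeasurable
    (ae_of_all _ fun y s _ => hC t (by simp) _) (integrable_const C)
    (ae_of_all _ fun y s _ => by
      simpa only [add_sub_right_comm] using hasDerivAt_polyKernel_line P i t (x - y) s)).2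
  simp only [zero_smul, add_zero] at h
  exact h

lemma hasDerivAt_polyFlow (P : HeatPoly d) {t : ℝ} (ht : 0 < t) (x : EuclideanSpace ℝ (Fin d)) :
    HasDerivAt (fun t => polyFlow μ P t x) (polyFlow μ (timeDeriv P) t x) t := by
  have ht2 : t / 2 < t := half_lt_self ht
  obtain ⟨C, hC⟩ := exists_abs_polyKernel_le_const (timeDeriv P) (half_pos ht)
    (ht2.trans (lt_add_one t)).le
  refine (hasDerivAt_integral_of_dominated_loc_of_deriv_le (μ := μ) (bound := fun _ => C)
    (F := fun t y => polyKernel P t (x - y)) (Icc_mem_nhds ht2 (lt_add_one t))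
    (.of_forall fun s => (continuous_polyKernel_sub P s x).aestronglyMeasurable)
    (integrable_polyKernel_sub μ P ht x)
    (continuous_polyKernel_sub _ t x).aestronglyMeasurable
    (ae_of_all _ fun y s hs => hC s hs _) (integrable_const C)
    (ae_of_all _ fun y s hs => hasDerivAt_polyKernel P ((half_pos ht).trans_le hs.1) _)).2

lemma continuous_measureHeatFlow {t : ℝ} (ht : 0 < t) : Continuous (measureHeatFlow μ t) := by
  simpa only [polyFlow_one] using continuous_polyFlow μ 1 ht

lemma exists_measureHeatFlow_le {a b : ℝ} (ha : 0 < a) (hab : a ≤ b) :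
    ∃ M, ∀ t ∈ Icc a b, ∀ x, measureHeatFlow μ t x ≤ M := by
  obtain ⟨C, hC⟩ := exists_abs_polyKernel_le_const (d := d) 1 ha hab
  refine ⟨C * μ.real univ, fun t ht x => ?_⟩
  rw [← polyFlow_one, polyFlow]
  exact (Real.le_norm_self _).trans
    (norm_integral_le_of_norm_le_const (ae_of_all _ fun y => hC t ht (x - y)))

lemma integrable_measureHeatFlow {t : ℝ} (ht : 0 < t) : Integrable (measureHeatFlow μ t) := by
  rw [← polyFlow_one]
  exact integrable_integral_sub μ (integrable_polyKernel 1 ht)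

lemma integral_measureHeatFlow {t : ℝ} (ht : 0 < t) :
    ∫ x, measureHeatFlow μ t x = μ.real univ := by
  have h := integral_integral_sub μ (integrable_polyKernel (d := d) 1 ht)
  rw [polyKernel_one, integral_heatKernel ht, mul_one] at h
  exact h

variable [NeZero μ]

lemma measureHeatFlow_pos {t : ℝ} (ht : 0 < t) (x : EuclideanSpace ℝ (Fin d)) :
    0 < measureHeatFlow μ t x := by
  have hint : Integrable (fun y => heatKernel d t (x - y)) μ := by
    simpa only [polyKernel_one] using integrable_polyKernel_sub μ 1 ht x
  have hsupp : Function.support (fun y => heatKernel d t (x - y)) = univ :=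
    eq_univ_of_forall fun y => (heatKernel_pos ht _).ne'
  rw [measureHeatFlow, integral_pos_iff_support_of_nonneg (fun y => (heatKernel_pos ht _).le) hint,
    hsupp]
  exact NeZero.pos _

end PolyFlow

lemma mul_abs_div_pow_le_integral {α : Type*} [MeasurableSpace α] {μ : Measure α} {f w : α → ℝ}
    {n : ℕ} (hw : ∀ y, 0 ≤ w y) (hwint : Integrable w μ) (hwpos : 0 < ∫ y, w y ∂μ)
    (hf : Integrable (fun y => f y * w y) μ) (hfn : Integrable (fun y => |f y| ^ n * w y) μ) :
    (∫ y, w y ∂μ) * |(∫ y, f y * w y ∂μ) / ∫ y, w y ∂μ| ^ n ≤ ∫ y, |f y| ^ n * w y ∂μ := by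
  set W := ∫ y, w y ∂μ
  set m := |(∫ y, f y * w y ∂μ) / W| with hm
  rcases n.eq_zero_or_pos with rfl | hn
  · simp [W]
  rcases (show 0 ≤ m from abs_nonneg _).eq_or_lt with hm0 | hmpos
  · rw [← hm0, zero_pow hn.ne', mul_zero]
    exact integral_nonneg fun y => mul_nonneg (by positivity) (hw y)
  have hfabs : Integrable (fun y => |f y| * w y) μ :=
    hf.abs.congr (ae_of_all _ fun y => by simp only [abs_mul, abs_of_nonneg (hw y)])
  have hmW : m * W ≤ ∫ y, |f y| * w y ∂μ := by
    rw [hm, abs_div, abs_of_pos hwpos, div_mul_cancel₀ _ hwpos.ne']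
    refine abs_integral_le_integral_abs.trans_eq (integral_congr_ae (ae_of_all _ fun y => ?_))
    simp only [abs_mul, abs_of_nonneg (hw y)]
  have htangent (y : α) : m ^ n * (1 - n) * w y + n * m ^ n / m * (|f y| * w y) ≤
      |f y| ^ n * w y := by
    have hbern := one_add_mul_le_pow (a := |f y| / m - 1)
      (by linarith [div_nonneg (abs_nonneg (f y)) hmpos.le]) n
    rw [add_sub_cancel, div_pow, le_div_iff₀ (by positivity)] at hbern
    refine le_trans (le_of_eq ?_) (mul_le_mul_of_nonneg_right hbern (hw y))
    field_simp
    ring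
  calc W * m ^ n = m ^ n * (1 - n) * W + n * m ^ n / m * (m * W) := by field_simp; ring
    _ ≤ m ^ n * (1 - n) * W + n * m ^ n / m * ∫ y, |f y| * w y ∂μ := by gcongr
    _ = ∫ y, m ^ n * (1 - n) * w y + n * m ^ n / m * (|f y| * w y) ∂μ := by
      rw [integral_add (hwint.const_mul _) (hfabs.const_mul _), integral_const_mul,
        integral_const_mul]
    _ ≤ ∫ y, |f y| ^ n * w y ∂μ :=
      integral_mono ((hwint.const_mul _).add (hfabs.const_mul _)) hfn htangent

section Score

open HeatPoly

variable {d : ℕ} (μ : Measure (EuclideanSpace ℝ (Fin d)))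

/-- The mean of the polynomial `P` under the law of the starting point of the heat flow
conditioned on its position `x` at time `t`. Logarithmic derivatives of the heat flow are of this
form, hence the name. -/
def score (P : HeatPoly d) (t : ℝ) (x : EuclideanSpace ℝ (Fin d)) : ℝ :=
  polyFlow μ P t x / measureHeatFlow μ t x

variable [IsFiniteMeasure μ]

lemma score_sum {ι : Type*} (s : Finset ι) (P : ι → HeatPoly d) {t : ℝ} (ht : 0 < t)
    (x : EuclideanSpace ℝ (Fin d)) : score μ (∑ k ∈ s, P k) t x = ∑ k ∈ s, score μ (P k) t x := by
  simp only [score, polyFlow_sum μ s P ht, Finset.sum_div]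

variable [NeZero μ]

lemma measureHeatFlow_mul_score (P : HeatPoly d) {t : ℝ} (ht : 0 < t)
    (x : EuclideanSpace ℝ (Fin d)) :
    measureHeatFlow μ t x * score μ P t x = polyFlow μ P t x :=
  mul_div_cancel₀ _ (measureHeatFlow_pos μ ht x).ne'

lemma continuous_score (P : HeatPoly d) {t : ℝ} (ht : 0 < t) : Continuous (score μ P t) :=
  (continuous_polyFlow μ P ht).div (continuous_measureHeatFlow μ ht)
    fun x => (measureHeatFlow_pos μ ht x).ne'

lemma hasLineDerivAt_measureHeatFlow (i : Fin d) {t : ℝ} (ht : 0 < t)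
    (x : EuclideanSpace ℝ (Fin d)) :
    HasLineDerivAt ℝ (measureHeatFlow μ t)
      (measureHeatFlow μ t x * score μ (spaceDeriv i 1) t x) x
      (EuclideanSpace.single i (1 : ℝ)) := by
  simpa only [polyFlow_one, measureHeatFlow_mul_score μ _ ht] using
    hasLineDerivAt_polyFlow μ 1 i ht x

lemma hasDerivAt_measureHeatFlow {t : ℝ} (ht : 0 < t) (x : EuclideanSpace ℝ (Fin d)) :
    HasDerivAt (fun t => measureHeatFlow μ t x)
      (measureHeatFlow μ t x * score μ (timeDeriv 1) t x) t := by
  simpa only [polyFlow_one, measureHeatFlow_mul_score μ _ ht] using hasDerivAt_polyFlow μ 1 ht x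

lemma hasLineDerivAt_score (P : HeatPoly d) (i : Fin d) {t : ℝ} (ht : 0 < t)
    (x : EuclideanSpace ℝ (Fin d)) :
    HasLineDerivAt ℝ (score μ P t)
      (score μ (spaceDeriv i P) t x - score μ P t x * score μ (spaceDeriv i 1) t x) x
      (EuclideanSpace.single i (1 : ℝ)) := by
  have hu := measureHeatFlow_pos μ ht x
  have h := HasDerivAt.fun_div (hasLineDerivAt_polyFlow μ P i ht x)
    (hasLineDerivAt_measureHeatFlow μ i ht x) (measureHeatFlow_pos μ ht _).ne'
  simp only [zero_smul, add_zero] at h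
  refine HasDerivAt.congr_deriv h ?_
  simp only [← measureHeatFlow_mul_score μ _ ht]
  field_simp

lemma hasDerivAt_score (P : HeatPoly d) {t : ℝ} (ht : 0 < t) (x : EuclideanSpace ℝ (Fin d)) :
    HasDerivAt (fun t => score μ P t x)
      (score μ (timeDeriv P) t x - score μ P t x * score μ (timeDeriv 1) t x) t := by
  have hu := measureHeatFlow_pos μ ht x
  refine (HasDerivAt.fun_div (hasDerivAt_polyFlow μ P ht x) (hasDerivAt_measureHeatFlow μ ht x)
    hu.ne').congr_deriv ?_
  simp only [← measureHeatFlow_mul_score μ _ ht]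
  field_simp

lemma measureHeatFlow_mul_abs_score_pow_le (P : HeatPoly d) (n : ℕ) {t : ℝ} (ht : 0 < t)
    (x : EuclideanSpace ℝ (Fin d)) :
    measureHeatFlow μ t x * |score μ P t x| ^ n ≤ ∫ y, |polyKernel (P ^ n) t (x - y)| ∂μ := by
  have hpow (y : EuclideanSpace ℝ (Fin d)) : |polyKernel (P ^ n) t (x - y)| =
      |eval (point t (x - y)) P| ^ n * heatKernel d t (x - y) := by
    rw [polyKernel, abs_mul, abs_of_pos (heatKernel_pos ht _), eval_pow, abs_pow]
  have hint := (integrable_polyKernel_sub μ (P ^ n) ht x).abs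
  simp only [hpow] at hint ⊢
  refine mul_abs_div_pow_le_integral (fun y => (heatKernel_pos ht _).le) ?_
    (measureHeatFlow_pos μ ht x) (integrable_polyKernel_sub μ P ht x) hint
  simpa only [polyKernel_one] using integrable_polyKernel_sub μ 1 ht x

end Score

section Moments

open HeatPoly

variable {d : ℕ}

/-- The functions `f t` are continuous and have finite moments of all orders with respect to the
heat flow of `μ`, uniformly on compact time intervals, in the strong sense of a common integrable
majorant. All integrations by parts and differentiations under the integral sign take place in
this algebra of functions. -/
structure HasHeatMoments (μ : Measure (EuclideanSpace ℝ (Fin d)))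
    (f : ℝ → EuclideanSpace ℝ (Fin d) → ℝ) : Prop where
  continuous : ∀ ⦃t⦄, 0 < t → Continuous (f t)
  exists_bound : ∀ ⦃a b : ℝ⦄, 0 < a → a ≤ b → ∀ n : ℕ, ∃ B, Integrable B ∧
    ∀ t ∈ Icc a b, ∀ x, measureHeatFlow μ t x * |f t x| ^ n ≤ B x

variable {μ : Measure (EuclideanSpace ℝ (Fin d))} [IsFiniteMeasure μ] [NeZero μ]

lemma hasHeatMoments_score (P : HeatPoly d) : HasHeatMoments μ (score μ P) where
  continuous _ ht := continuous_score μ P ht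
  exists_bound a b ha hab n := by
    have hb : 0 < b := ha.trans_le hab
    obtain ⟨C, hC⟩ := exists_abs_polyKernel_le (P ^ n) ha hab
    refine ⟨fun x => ∫ y, C * Real.exp (-(8 * b)⁻¹ * ‖x - y‖ ^ 2) ∂μ, integrable_integral_sub μ
      ((integrable_exp_neg_mul_norm_sq (by positivity)).const_mul C), fun t ht x => ?_⟩
    have htpos : 0 < t := ha.trans_le ht.1
    refine (measureHeatFlow_mul_abs_score_pow_le μ P n htpos x).trans <|
      integral_mono_of_nonneg (ae_of_all _ fun y => abs_nonneg _) ?_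
        (ae_of_all _ fun y => hC t ht _)
    refine .of_bound (by fun_prop) |C| (ae_of_all _ fun y => ?_)
    rw [norm_mul, Real.norm_eq_abs, Real.norm_eq_abs, Real.abs_exp]
    refine mul_le_of_le_one_right (abs_nonneg C) (Real.exp_le_one_iff.2 ?_)
    rw [neg_mul, neg_nonpos]
    positivity

namespace HasHeatMoments

variable {f f' g : ℝ → EuclideanSpace ℝ (Fin d) → ℝ}

lemma const (c : ℝ) : HasHeatMoments μ fun _ _ => c where
  continuous _ _ := continuous_const
  exists_bound a b ha hab n := by
    obtain ⟨B, hB, hle⟩ := (hasHeatMoments_score (μ := μ) 1).exists_bound ha hab 0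
    refine ⟨fun x => B x * |c| ^ n, hB.mul_const _, fun t ht x => ?_⟩
    have hu := hle t ht x
    rw [pow_zero, mul_one] at hu
    exact mul_le_mul_of_nonneg_right hu (by positivity)

lemma add (hf : HasHeatMoments μ f) (hg : HasHeatMoments μ g) :
    HasHeatMoments μ fun t x => f t x + g t x where
  continuous _ ht := (hf.continuous ht).add (hg.continuous ht)
  exists_bound a b ha hab n := by
    obtain ⟨B, hB, hfB⟩ := hf.exists_bound ha hab n
    obtain ⟨B', hB', hgB'⟩ := hg.exists_bound ha hab n
    refine ⟨fun x => 2 ^ (n - 1) * (B x + B' x), (hB.add hB').const_mul _, fun t ht x => ?_⟩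
    have hu := (measureHeatFlow_pos μ (ha.trans_le ht.1) x).le
    calc measureHeatFlow μ t x * |f t x + g t x| ^ n
        ≤ measureHeatFlow μ t x * (2 ^ (n - 1) * (|f t x| ^ n + |g t x| ^ n)) := by
          gcongr
          exact (pow_le_pow_left₀ (abs_nonneg _) (abs_add_le _ _) n).trans
            (add_pow_le (abs_nonneg _) (abs_nonneg _) n)
      _ = 2 ^ (n - 1) * (measureHeatFlow μ t x * |f t x| ^ n +
          measureHeatFlow μ t x * |g t x| ^ n) := by ring
      _ ≤ 2 ^ (n - 1) * (B x + B' x) := by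
          gcongr
          exacts [hfB t ht x, hgB' t ht x]

lemma mul (hf : HasHeatMoments μ f) (hg : HasHeatMoments μ g) :
    HasHeatMoments μ fun t x => f t x * g t x where
  continuous _ ht := (hf.continuous ht).mul (hg.continuous ht)
  exists_bound a b ha hab n := by
    obtain ⟨B, hB, hfB⟩ := hf.exists_bound ha hab (n * 2)
    obtain ⟨B', hB', hgB'⟩ := hg.exists_bound ha hab (n * 2)
    refine ⟨fun x => B x + B' x, hB.add hB', fun t ht x => ?_⟩
    have hu := (measureHeatFlow_pos μ (ha.trans_le ht.1) x).le
    calc measureHeatFlow μ t x * |f t x * g t x| ^ n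
        ≤ measureHeatFlow μ t x * (|f t x| ^ (n * 2) + |g t x| ^ (n * 2)) := by
          gcongr
          rw [abs_mul, mul_pow, pow_mul, pow_mul]
          nlinarith [sq_nonneg (|f t x| ^ n - |g t x| ^ n), sq_nonneg (|f t x| ^ n),
            sq_nonneg (|g t x| ^ n)]
      _ ≤ B x + B' x := by
          rw [mul_add]
          exact add_le_add (hfB t ht x) (hgB' t ht x)

lemma const_mul (c : ℝ) (hf : HasHeatMoments μ f) : HasHeatMoments μ fun t x => c * f t x :=
  (const c).mul hf

lemma sub (hf : HasHeatMoments μ f) (hg : HasHeatMoments μ g) :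
    HasHeatMoments μ fun t x => f t x - g t x := by
  simpa only [neg_one_mul, ← sub_eq_add_neg] using hf.add (hg.const_mul (-1))

lemma sum {ι : Type*} {s : Finset ι} {F : ι → ℝ → EuclideanSpace ℝ (Fin d) → ℝ}
    (hF : ∀ k, HasHeatMoments μ (F k)) : HasHeatMoments μ fun t x => ∑ k ∈ s, F k t x := by
  induction s using Finset.cons_induction with
  | empty => simpa only [Finset.sum_empty] using const 0
  | cons k s hk ih => simpa only [Finset.sum_cons] using (hF k).add ih

lemma pow (hf : HasHeatMoments μ f) (n : ℕ) : HasHeatMoments μ fun t x => f t x ^ n := by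
  induction n with
  | zero => simpa only [pow_zero] using const 1
  | succ n ih => simpa only [pow_succ] using ih.mul hf

lemma exists_abs_rpow_mul_le (hf : HasHeatMoments μ f) {a b : ℝ} (ha : 0 < a) (hab : a ≤ b)
    (Q : ℝ) : ∃ B, Integrable B ∧ ∀ t ∈ Icc a b, ∀ q ∈ Icc 1 Q, ∀ x,
      |measureHeatFlow μ t x ^ q * f t x| ≤ B x := by
  obtain ⟨M, hM⟩ := exists_measureHeatFlow_le μ ha hab
  obtain ⟨B, hB, hle⟩ := hf.exists_bound ha hab 1
  refine ⟨fun x => max M 1 ^ (Q - 1) * B x, hB.const_mul _, fun t ht q hq x => ?_⟩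
  have hu := measureHeatFlow_pos μ (ha.trans_le ht.1) x
  have hsplit : measureHeatFlow μ t x ^ q =
      measureHeatFlow μ t x ^ (q - 1) * measureHeatFlow μ t x := by
    rw [Real.rpow_sub_one hu.ne', div_mul_cancel₀ _ hu.ne']
  have hpow : measureHeatFlow μ t x ^ (q - 1) ≤ max M 1 ^ (Q - 1) :=
    (Real.rpow_le_rpow hu.le ((hM t ht x).trans (le_max_left _ _)) (by linarith [hq.1])).trans
      (Real.rpow_le_rpow_of_exponent_le (le_max_right _ _) (by linarith [hq.2]))
  rw [abs_mul, abs_of_nonneg (by positivity), hsplit, mul_assoc]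
  refine mul_le_mul hpow ?_ (by positivity) (by positivity)
  simpa only [pow_one] using hle t ht x

lemma continuous_rpow_mul (hf : HasHeatMoments μ f) (q : ℝ) {t : ℝ} (ht : 0 < t) :
    Continuous fun x => measureHeatFlow μ t x ^ q * f t x :=
  ((continuous_measureHeatFlow μ ht).rpow_const
    fun x => Or.inl (measureHeatFlow_pos μ ht x).ne').mul (hf.continuous ht)

lemma integrable_rpow_mul (hf : HasHeatMoments μ f) {q : ℝ} (hq : 1 ≤ q) {t : ℝ} (ht : 0 < t) :
    Integrable fun x => measureHeatFlow μ t x ^ q * f t x := by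
  obtain ⟨B, hB, hle⟩ := hf.exists_abs_rpow_mul_le ht le_rfl q
  exact hB.mono' (hf.continuous_rpow_mul q ht).aestronglyMeasurable
    (ae_of_all _ (hle t (by simp) q ⟨hq, le_rfl⟩))

lemma hasDerivAt_integral_rpow_mul (hf : HasHeatMoments μ f) (hf' : HasHeatMoments μ f')
    (hderiv : ∀ ⦃t⦄, 0 < t → ∀ x, HasDerivAt (fun t => f t x) (f' t x) t) {q : ℝ} (hq : 1 ≤ q)
    {t : ℝ} (ht : 0 < t) :
    HasDerivAt (fun t => ∫ x, measureHeatFlow μ t x ^ q * f t x)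
      (∫ x, measureHeatFlow μ t x ^ q * (q * score μ (timeDeriv 1) t x * f t x + f' t x)) t := by
  have hmom : HasHeatMoments μ fun t x => q * score μ (timeDeriv 1) t x * f t x + f' t x :=
    (((hasHeatMoments_score _).const_mul q).mul hf).add hf'
  have ht2 : t / 2 < t := half_lt_self ht
  obtain ⟨B, hB, hle⟩ := hmom.exists_abs_rpow_mul_le (half_pos ht) (ht2.trans (lt_add_one t)).le q
  refine (hasDerivAt_integral_of_dominated_loc_of_deriv_le (bound := B)
    (F := fun t x => measureHeatFlow μ t x ^ q * f t x) (Icc_mem_nhds ht2 (lt_add_one t))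
    ((lt_mem_nhds ht).mono fun s hs => (hf.continuous_rpow_mul q hs).aestronglyMeasurable)
    (hf.integrable_rpow_mul hq ht) (hmom.continuous_rpow_mul q ht).aestronglyMeasurable
    (ae_of_all _ fun x s hs => hle s hs q ⟨hq, le_rfl⟩ x) hB (ae_of_all _ fun x s hs => ?_)).2
  have hspos : 0 < s := (half_pos ht).trans_le hs.1
  have hu := measureHeatFlow_pos μ hspos x
  refine (((hasDerivAt_measureHeatFlow μ hspos x).rpow_const (p := q) (Or.inl hu.ne')).mul
    (hderiv hspos x)).congr_deriv ?_
  rw [Real.rpow_sub_one hu.ne']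
  field_simp

end HasHeatMoments

lemma hasLineDerivAt_mul {E : Type*} [AddCommGroup E] [Module ℝ E] {f g : E → ℝ} {f' g' : ℝ}
    {x v : E} (hf : HasLineDerivAt ℝ f f' x v) (hg : HasLineDerivAt ℝ g g' x v) :
    HasLineDerivAt ℝ (fun x => f x * g x) (f' * g x + f x * g') x v := by
  simpa only [HasLineDerivAt, zero_smul, add_zero] using HasDerivAt.fun_mul hf hg

lemma integral_eq_zero_of_hasLineDerivAt {E : Type*} [NormedAddCommGroup E] [NormedSpace ℝ E]
    [FiniteDimensional ℝ E] [MeasurableSpace E] [BorelSpace E] {ν : Measure E} [ν.IsAddHaarMeasure]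
    {f f' : E → ℝ} {v : E} (hf : Integrable f ν) (hf' : Integrable f' ν)
    (h : ∀ x, HasLineDerivAt ℝ f (f' x) x v) : ∫ x, f' x ∂ν = 0 := by
  simpa using integral_bilinear_hasLineDerivAt_right_eq_neg_left_of_integrable (μ := ν)
    (B := ContinuousLinearMap.mul ℝ ℝ) (f := fun _ => (1 : ℝ)) (f' := fun _ => 0) (g := f)
    (g' := f') (v := v) (by simp) (by simpa using hf') (by simpa using hf)
    (fun x _ => hasDerivAt_const _ _) (fun x _ => h x)

lemma integral_rpow_mul_divergence_eq_zero {F F' : Fin d → ℝ → EuclideanSpace ℝ (Fin d) → ℝ}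
    (hF : ∀ i, HasHeatMoments μ (F i)) (hF' : ∀ i, HasHeatMoments μ (F' i)) {q : ℝ} (hq : 1 ≤ q)
    {t : ℝ} (ht : 0 < t) (hderiv : ∀ i x,
      HasLineDerivAt ℝ (F i t) (F' i t x) x (EuclideanSpace.single i (1 : ℝ))) :
    ∫ x, measureHeatFlow μ t x ^ q *
      ∑ i, (q * score μ (spaceDeriv i 1) t x * F i t x + F' i t x) = 0 := by
  have hmom (i : Fin d) :
      HasHeatMoments μ fun t x => q * score μ (spaceDeriv i 1) t x * F i t x + F' i t x :=
    (((hasHeatMoments_score _).const_mul q).mul (hF i)).add (hF' i)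
  simp only [Finset.mul_sum]
  rw [integral_finsetSum _ fun i _ => (hmom i).integrable_rpow_mul hq ht]
  refine Finset.sum_eq_zero fun i _ => integral_eq_zero_of_hasLineDerivAt
    (v := EuclideanSpace.single i (1 : ℝ))
    ((hF i).integrable_rpow_mul hq ht) ((hmom i).integrable_rpow_mul hq ht) fun x => ?_
  have hu := measureHeatFlow_pos μ ht x
  have hpow : HasLineDerivAt ℝ (fun x => measureHeatFlow μ t x ^ q) _ x _ :=
    (hasLineDerivAt_measureHeatFlow μ i ht x).rpow_const (p := q)
      (Or.inl (measureHeatFlow_pos μ ht _).ne')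
  refine HasDerivAt.congr_deriv (hasLineDerivAt_mul hpow (hderiv i x)) ?_
  simp only [zero_smul, add_zero]
  rw [Real.rpow_sub_one hu.ne']
  field_simp

end Moments

section FisherInformation

open HeatPoly

variable {d : ℕ} (μ : Measure (EuclideanSpace ℝ (Fin d)))

/-- The quotient `∂ᵢu / u = ∂ᵢ log u` of the heat flow `u`. -/
abbrev logGrad (i : Fin d) : ℝ → EuclideanSpace ℝ (Fin d) → ℝ := score μ (spaceDeriv i 1)

/-- The quotient `∂ᵢ∂ⱼu / u` of the heat flow `u`; this is not the Hessian of `log u`. -/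
abbrev relHess (i j : Fin d) : ℝ → EuclideanSpace ℝ (Fin d) → ℝ :=
  score μ (spaceDeriv i (spaceDeriv j 1))

/-- The quotient `Δu / u = ∂ₜu / u` of the heat flow `u`. -/
abbrev relLap : ℝ → EuclideanSpace ℝ (Fin d) → ℝ := score μ (timeDeriv 1)

/-- The quotient `∂ᵢΔu / u` of the heat flow `u`. -/
abbrev relGradLap (i : Fin d) : ℝ → EuclideanSpace ℝ (Fin d) → ℝ :=
  score μ (timeDeriv (spaceDeriv i 1))

/-- The Fisher information `∫ u ^ q |∇ log u|²` of the heat flow `u`; `q` times it is the entropy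
production. -/
def fisherInfo (q t : ℝ) : ℝ :=
  ∫ x, measureHeatFlow μ t x ^ q * ∑ i, logGrad μ i t x ^ 2

variable [IsFiniteMeasure μ]

lemma relHess_trace {t : ℝ} (ht : 0 < t) (x : EuclideanSpace ℝ (Fin d)) :
    ∑ i, relHess μ i i t x = relLap μ t x := by
  rw [relLap, timeDeriv_one, score_sum μ _ _ ht]

variable [NeZero μ]

lemma hasLineDerivAt_relLap (i : Fin d) {t : ℝ} (ht : 0 < t) (x : EuclideanSpace ℝ (Fin d)) :
    HasLineDerivAt ℝ (relLap μ t) (relGradLap μ i t x - relLap μ t x * logGrad μ i t x) x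
      (EuclideanSpace.single i (1 : ℝ)) := by
  rw [relGradLap, timeDeriv_spaceDeriv]
  exact hasLineDerivAt_score μ _ i ht x

variable {μ}

lemma hasHeatMoments_sum_logGrad_sq : HasHeatMoments μ fun t x => ∑ i, logGrad μ i t x ^ 2 :=
  .sum fun _ => (hasHeatMoments_score _).pow 2

lemma hasDerivAt_sum_logGrad_sq {t : ℝ} (ht : 0 < t) (x : EuclideanSpace ℝ (Fin d)) :
    HasDerivAt (fun t => ∑ i, logGrad μ i t x ^ 2)
      (∑ i, 2 * logGrad μ i t x * (relGradLap μ i t x - logGrad μ i t x * relLap μ t x)) t := by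
  refine HasDerivAt.fun_sum fun i _ => ?_
  simpa using (hasDerivAt_score μ (spaceDeriv i 1) ht x).fun_pow 2

variable (μ) in
lemma hasDerivAt_integral_rpow {q : ℝ} (hq : 1 ≤ q) {t : ℝ} (ht : 0 < t) :
    HasDerivAt (fun t => ∫ x, measureHeatFlow μ t x ^ q) (-(q * (q - 1) * fisherInfo μ q t)) t := by
  have hderiv := (HasHeatMoments.const (μ := μ) 1).hasDerivAt_integral_rpow_mul (.const 0)
    (fun t _ _ => hasDerivAt_const t 1) hq ht
  have hdiv := integral_rpow_mul_divergence_eq_zero (μ := μ) (q := q)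
    (fun i => hasHeatMoments_score (spaceDeriv i 1))
    (fun i => (hasHeatMoments_score (spaceDeriv i (spaceDeriv i 1))).sub
      ((hasHeatMoments_score (spaceDeriv i 1)).mul (hasHeatMoments_score (spaceDeriv i 1))))
    hq ht (fun i x => hasLineDerivAt_score μ _ i ht x)
  have hlap := (hasHeatMoments_score (μ := μ) (timeDeriv 1)).integrable_rpow_mul hq ht
  have hfisher := (hasHeatMoments_sum_logGrad_sq (μ := μ)).integrable_rpow_mul hq ht
  have hsum (x : EuclideanSpace ℝ (Fin d)) : measureHeatFlow μ t x ^ q *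
      ∑ i, (q * logGrad μ i t x * logGrad μ i t x +
        (relHess μ i i t x - logGrad μ i t x * logGrad μ i t x)) =
      (q - 1) * (measureHeatFlow μ t x ^ q * ∑ i, logGrad μ i t x ^ 2) +
        measureHeatFlow μ t x ^ q * relLap μ t x := by
    rw [← relHess_trace μ ht, Finset.sum_add_distrib, Finset.sum_sub_distrib]
    simp only [mul_assoc, ← Finset.mul_sum, ← pow_two]
    ring
  simp only [hsum] at hdiv
  rw [integral_add (hfisher.const_mul _) hlap, integral_const_mul] at hdiv
  simp only [mul_one, add_zero, mul_left_comm _ q, integral_const_mul] at hderiv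
  refine hderiv.congr_deriv ?_
  simp only [fisherInfo]
  linear_combination q * hdiv

end FisherInformation

section DissipationForm

variable {ι : Type*} [Fintype ι]

/-- The quadratic form in `g ⊗ g` and `H` whose integral is minus the time derivative of the
Fisher information, with `g = ∇u / u`, `H = D²u / u` and `p = q - 2`. The parameters `l`, `β`, `γ`
with `l + β = 2` are the multiples in which the divergences of `u ^ q Tr(H) g`, `u ^ q H g` and
`u ^ q |g|² g` are added. -/
def dissipationForm (p l β γ : ℝ) (g : ι → ℝ) (H : ι → ι → ℝ) : ℝ :=
  l * (∑ i, H i i) ^ 2 + β * ∑ i, ∑ j, H i j ^ 2 +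
    (l * p - p + γ) * ((∑ i, H i i) * ∑ i, g i ^ 2) +
    (β * p + 2 * γ) * ∑ i, ∑ j, H i j * g i * g j + γ * (p - 1) * (∑ i, g i ^ 2) ^ 2

lemma sum_sum_add_mul_mul_sq (c : ℝ) (g : ι → ℝ) (H : ι → ι → ℝ) :
    ∑ i, ∑ j, (H i j + c * (g i * g j)) ^ 2 =
      ∑ i, ∑ j, H i j ^ 2 + 2 * c * ∑ i, ∑ j, H i j * g i * g j + c ^ 2 * (∑ i, g i ^ 2) ^ 2 := by
  rw [sq (∑ i, g i ^ 2), Finset.sum_mul_sum]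
  simp only [Finset.mul_sum, ← Finset.sum_add_distrib]
  exact Finset.sum_congr rfl fun i _ => Finset.sum_congr rfl fun j _ => by ring

lemma dissipationForm_nonneg_of_mem_Icc {p : ℝ} (hp : p ∈ Icc (-1) 0) (g : ι → ℝ)
    (H : ι → ι → ℝ) : 0 ≤ dissipationForm p 0 2 p g H := by
  have hsq : dissipationForm p 0 2 p g H =
      2 * ∑ i, ∑ j, (H i j + p * (g i * g j)) ^ 2 + -p * (1 + p) * (∑ i, g i ^ 2) ^ 2 := by
    rw [sum_sum_add_mul_mul_sq, dissipationForm]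
    ring
  have hp' : 0 ≤ -p * (1 + p) := mul_nonneg (by linarith [hp.2]) (by linarith [hp.1])
  rw [hsq]
  positivity

lemma dissipationForm_nonneg_of_sq_le {p : ℝ} (hp : p ^ 2 ≤ 4 / 5) (g : ι → ℝ)
    (H : ι → ι → ℝ) : 0 ≤ dissipationForm p 1 1 (-2 / 5) g H := by
  have hsq : dissipationForm p 1 1 (-2 / 5) g H =
      (∑ i, H i i - 1 / 5 * ∑ i, g i ^ 2) ^ 2 +
        ∑ i, ∑ j, (H i j + (p / 2 - 2 / 5) * (g i * g j)) ^ 2 +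
        (4 / 5 - p ^ 2) / 4 * (∑ i, g i ^ 2) ^ 2 := by
    rw [sum_sum_add_mul_mul_sq, dissipationForm]
    ring
  rw [hsq]
  have hcoeff : 0 ≤ (4 / 5 - p ^ 2) / 4 := by linarith
  exact add_nonneg (by positivity) (mul_nonneg hcoeff (sq_nonneg _))

lemma dissipationForm_nonneg_of_unique [Unique ι] {p : ℝ} (hp : p ∈ Icc 0 1) (g : ι → ℝ)
    (H : ι → ι → ℝ) : 0 ≤ dissipationForm p 2 0 (-p / 3) g H := by
  have hsq : dissipationForm p 2 0 (-p / 3) g H =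
      2 * H default default ^ 2 + p * (1 - p) / 3 * g default ^ 4 := by
    simp only [dissipationForm, Fintype.sum_unique]
    ring
  have hp' : 0 ≤ p * (1 - p) := mul_nonneg hp.1 (by linarith [hp.2])
  rw [hsq]
  positivity

lemma exists_dissipationForm_nonneg {d : ℕ} {q : ℝ}
    (hq : (d = 1 ∧ q ∈ Icc (1 : ℝ) 3) ∨
      (1 < d ∧ q ∈ Icc (1 : ℝ) (2 * (Real.sqrt 5 + 1) / Real.sqrt 5))) :
    ∃ l β γ : ℝ, l + β = 2 ∧
      ∀ (g : Fin d → ℝ) (H : Fin d → Fin d → ℝ), 0 ≤ dissipationForm (q - 2) l β γ g H := by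
  have hq1 : 1 ≤ q := hq.elim (fun h => h.2.1) fun h => h.2.1
  rcases le_total q 2 with hq2 | hq2
  · exact ⟨0, 2, q - 2, by norm_num,
      dissipationForm_nonneg_of_mem_Icc ⟨by linarith, by linarith⟩⟩
  rcases hq with ⟨rfl, -, hq3⟩ | ⟨-, -, hq3⟩
  · exact ⟨2, 0, -(q - 2) / 3, by norm_num,
      dissipationForm_nonneg_of_unique ⟨by linarith, by linarith⟩⟩
  · refine ⟨1, 1, -2 / 5, by norm_num, dissipationForm_nonneg_of_sq_le ?_⟩
    have hsub : q - 2 ≤ 2 / Real.sqrt 5 := by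
      have : 2 * (Real.sqrt 5 + 1) / Real.sqrt 5 = 2 + 2 / Real.sqrt 5 := by field_simp
      linarith
    calc (q - 2) ^ 2 ≤ (2 / Real.sqrt 5) ^ 2 := pow_le_pow_left₀ (by linarith) hsub 2
      _ = 4 / 5 := by rw [div_pow, Real.sq_sqrt (by norm_num)]; norm_num

end DissipationForm

section Dissipation

open HeatPoly

variable {d : ℕ} {μ : Measure (EuclideanSpace ℝ (Fin d))} [IsFiniteMeasure μ] [NeZero μ]
  {q t : ℝ}

lemma hasDerivAt_fisherInfo (hq : 1 ≤ q) (ht : 0 < t) :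
    HasDerivAt (fisherInfo μ q) (∫ x, measureHeatFlow μ t x ^ q *
      ((q - 2) * (relLap μ t x * ∑ i, logGrad μ i t x ^ 2) +
        2 * ∑ i, logGrad μ i t x * relGradLap μ i t x)) t := by
  have hmom : HasHeatMoments μ fun t x =>
      ∑ i, 2 * logGrad μ i t x * (relGradLap μ i t x - logGrad μ i t x * relLap μ t x) :=
    .sum fun i => ((hasHeatMoments_score _).const_mul 2).mul
      ((hasHeatMoments_score _).sub ((hasHeatMoments_score _).mul (hasHeatMoments_score _)))
  refine (hasHeatMoments_sum_logGrad_sq.hasDerivAt_integral_rpow_mul hmom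
    (fun _ ht x => hasDerivAt_sum_logGrad_sq ht x) hq ht).congr_deriv ?_
  refine integral_congr_ae (ae_of_all _ fun x => ?_)
  simp only [Finset.mul_sum, ← Finset.sum_add_distrib]
  exact Finset.sum_congr rfl fun i _ => by ring

lemma integral_lap_smul_grad_divergence (hq : 1 ≤ q) (ht : 0 < t) :
    ∫ x, measureHeatFlow μ t x ^ q *
      ((q - 2) * (relLap μ t x * ∑ i, logGrad μ i t x ^ 2) +
        ∑ i, logGrad μ i t x * relGradLap μ i t x + relLap μ t x ^ 2) = 0 := by
  have hs := hasHeatMoments_score (μ := μ)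
  rw [← integral_rpow_mul_divergence_eq_zero (fun i => (hs _).mul (hs _))
    (fun i => (((hs _).sub ((hs _).mul (hs _))).mul (hs _)).add
      ((hs _).mul ((hs _).sub ((hs _).mul (hs _)))))
    hq ht fun i x => hasLineDerivAt_mul (hasLineDerivAt_relLap μ i ht x)
      (hasLineDerivAt_score μ (spaceDeriv i 1) i ht x)]
  refine integral_congr_ae (ae_of_all _ fun x => ?_)
  simp only [sq (relLap μ t x)]
  nth_rw 3 [← relHess_trace μ ht]
  simp only [Finset.mul_sum, ← Finset.sum_add_distrib]
  exact Finset.sum_congr rfl fun i _ => by ring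

lemma integral_hess_grad_divergence (hq : 1 ≤ q) (ht : 0 < t) :
    ∫ x, measureHeatFlow μ t x ^ q *
      ((q - 2) * ∑ i, ∑ j, relHess μ i j t x * logGrad μ i t x * logGrad μ j t x +
        ∑ i, logGrad μ i t x * relGradLap μ i t x + ∑ i, ∑ j, relHess μ i j t x ^ 2) = 0 := by
  have hs := hasHeatMoments_score (μ := μ)
  rw [← integral_rpow_mul_divergence_eq_zero
    (fun i => .sum (s := Finset.univ) fun j => (hs _).mul (hs _))
    (fun i => .sum fun j => (((hs _).sub ((hs _).mul (hs _))).mul (hs _)).add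
      ((hs _).mul ((hs _).sub ((hs _).mul (hs _)))))
    hq ht fun i x => HasDerivAt.fun_sum fun j _ => hasLineDerivAt_mul
      (hasLineDerivAt_score μ (spaceDeriv i (spaceDeriv j 1)) i ht x)
      (hasLineDerivAt_score μ (spaceDeriv j 1) i ht x)]
  refine integral_congr_ae (ae_of_all _ fun x => ?_)
  have hthird : ∑ j, logGrad μ j t x * relGradLap μ j t x = ∑ i, ∑ j, logGrad μ j t x *
      score μ (spaceDeriv i (spaceDeriv i (spaceDeriv j 1))) t x := by
    rw [Finset.sum_comm]
    simp only [← Finset.mul_sum, ← score_sum μ _ _ ht, sum_spaceDeriv_spaceDeriv_spaceDeriv_one]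
  simp only [hthird, Finset.mul_sum, ← Finset.sum_add_distrib]
  exact Finset.sum_congr rfl fun i _ => Finset.sum_congr rfl fun j _ => by ring

lemma integral_norm_sq_smul_grad_divergence (hq : 1 ≤ q) (ht : 0 < t) :
    ∫ x, measureHeatFlow μ t x ^ q *
      ((q - 3) * (∑ i, logGrad μ i t x ^ 2) ^ 2 +
        2 * ∑ i, ∑ j, relHess μ i j t x * logGrad μ i t x * logGrad μ j t x +
        relLap μ t x * ∑ i, logGrad μ i t x ^ 2) = 0 := by
  have hs := hasHeatMoments_score (μ := μ)
  rw [← integral_rpow_mul_divergence_eq_zero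
    (fun i => (HasHeatMoments.sum (s := Finset.univ) fun j => (hs _).mul (hs _)).mul
      (hs (spaceDeriv i 1)))
    (fun i => ((HasHeatMoments.sum fun j =>
      (((hs _).sub ((hs _).mul (hs _))).mul (hs _)).add
        ((hs _).mul ((hs _).sub ((hs _).mul (hs _))))).mul (hs _)).add
      ((HasHeatMoments.sum fun j => (hs _).mul (hs _)).mul ((hs _).sub ((hs _).mul (hs _)))))
    hq ht fun i x => hasLineDerivAt_mul
      (HasDerivAt.fun_sum fun j _ => hasLineDerivAt_mul
        (hasLineDerivAt_score μ (spaceDeriv j 1) i ht x)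
        (hasLineDerivAt_score μ (spaceDeriv j 1) i ht x))
      (hasLineDerivAt_score μ (spaceDeriv i 1) i ht x)]
  refine integral_congr_ae (ae_of_all _ fun x => ?_)
  simp only [← relHess_trace μ ht, sq (∑ i, logGrad μ i t x ^ 2), Finset.sum_mul_sum]
  simp only [Finset.mul_sum, Finset.sum_mul, ← Finset.sum_add_distrib]
  exact Finset.sum_congr rfl fun i _ => Finset.sum_congr rfl fun j _ => by ring

/-- The integral of `u ^ q` times a divergence vanishes, which permits to add arbitrary multiples of
the three divergences; the condition `l + β = 2` cancels the terms with third derivatives. -/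
lemma hasDerivAt_fisherInfo_dissipationForm (hq : 1 ≤ q) (ht : 0 < t) {l β : ℝ} (hlβ : l + β = 2)
    (γ : ℝ) :
    HasDerivAt (fisherInfo μ q) (-∫ x, measureHeatFlow μ t x ^ q *
      dissipationForm (q - 2) l β γ (fun i => logGrad μ i t x) fun i j => relHess μ i j t x) t := by
  have hs := hasHeatMoments_score (μ := μ)
  have hLs := (hs (timeDeriv 1)).mul hasHeatMoments_sum_logGrad_sq
  have hR : HasHeatMoments μ fun t x => ∑ i, logGrad μ i t x * relGradLap μ i t x :=
    .sum fun i => (hs _).mul (hs _)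
  have hH : HasHeatMoments μ fun t x =>
      ∑ i, ∑ j, relHess μ i j t x * logGrad μ i t x * logGrad μ j t x :=
    .sum fun i => .sum fun j => ((hs _).mul (hs _)).mul (hs _)
  have hHH : HasHeatMoments μ fun t x => ∑ i, ∑ j, relHess μ i j t x ^ 2 :=
    .sum fun i => .sum fun j => (hs _).pow 2
  have hX := ((hLs.const_mul (q - 2)).add (hR.const_mul 2)).integrable_rpow_mul hq ht
  have hA := ((((hLs.const_mul (q - 2)).add hR).add ((hs (timeDeriv 1)).pow 2)).integrable_rpow_mul
    hq ht).const_mul l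
  have hB := ((((hH.const_mul (q - 2)).add hR).add hHH).integrable_rpow_mul hq ht).const_mul β
  have hC := (((((hasHeatMoments_sum_logGrad_sq.pow 2).const_mul (q - 3)).add
    (hH.const_mul 2)).add hLs).integrable_rpow_mul hq ht).const_mul γ
  have hdiv := integral_sub' ((hA.add hB).add hC) hX
  rw [integral_add' (hA.add hB) hC, integral_add' hA hB] at hdiv
  simp only [integral_const_mul, integral_lap_smul_grad_divergence hq ht,
    integral_hess_grad_divergence hq ht, integral_norm_sq_smul_grad_divergence hq ht, mul_zero,
    add_zero, zero_sub] at hdiv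
  refine (hasDerivAt_fisherInfo hq ht).congr_deriv (neg_eq_iff_eq_neg.1 (hdiv.symm.trans ?_))
  refine integral_congr_ae (ae_of_all _ fun x => ?_)
  simp only [Pi.sub_apply, Pi.add_apply, dissipationForm, relHess_trace μ ht]
  linear_combination measureHeatFlow μ t x ^ q *
    (∑ i, logGrad μ i t x * relGradLap μ i t x) * hlβ

end Dissipation

section TsallisIntegrand

/-- The difference quotient `(x ^ q - x) / (q - 1)`, which tends to `x log x` as `q → 1`. Minus its
integral along a probability density is the Tsallis entropy of index `q ≠ 1`. -/
def tsallisIntegrand (q x : ℝ) : ℝ := (x ^ q - x) / (q - 1)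

variable {q x : ℝ}

lemma mul_log_le_tsallisIntegrand (hq : 1 < q) (hx : 0 ≤ x) :
    x * Real.log x ≤ tsallisIntegrand q x := by
  rcases hx.eq_or_lt with rfl | hx
  · simp [tsallisIntegrand, Real.zero_rpow (zero_lt_one.trans hq).ne']
  have hexp : Real.log x * (q - 1) + 1 ≤ x ^ (q - 1) := by
    rw [Real.rpow_def_of_pos hx]
    exact Real.add_one_le_exp _
  have hpow : x ^ q = x * x ^ (q - 1) := by
    rw [← Real.rpow_one_add' hx.le (by linarith), add_sub_cancel]
  rw [tsallisIntegrand, le_div_iff₀ (sub_pos.2 hq), hpow]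
  nlinarith

lemma tsallisIntegrand_le_sq (hq : q ∈ Ioc 1 2) (hx : 0 ≤ x) : tsallisIntegrand q x ≤ x ^ 2 := by
  have hpow : x ^ q = x * x ^ (q - 1) := by
    rw [← Real.rpow_one_add' hx (by linarith [hq.1]), add_sub_cancel]
  have hbernoulli : x ^ (q - 1) ≤ 1 + (q - 1) * (x - 1) := by
    simpa using rpow_one_add_le_one_add_mul_self (s := x - 1) (p := q - 1) (by linarith)
      (by linarith [hq.1]) (by linarith [hq.2])
  rw [tsallisIntegrand, div_le_iff₀ (sub_pos.2 hq.1), hpow]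
  nlinarith [mul_le_mul_of_nonneg_left hbernoulli hx, mul_nonneg hx (sub_pos.2 hq.1).le]

lemma tendsto_tsallisIntegrand (hx : 0 ≤ x) :
    Tendsto (fun q => tsallisIntegrand q x) (𝓝[>] 1) (𝓝 (x * Real.log x)) := by
  rcases hx.eq_or_lt with rfl | hx
  · refine (tendsto_congr' ?_).2 (tendsto_const_nhds (x := (0 : ℝ) * Real.log 0))
    filter_upwards [self_mem_nhdsWithin] with q hq
    simp [tsallisIntegrand, Real.zero_rpow (zero_lt_one.trans hq).ne']
  have hslope := hasDerivAt_iff_tendsto_slope.1 (Real.hasStrictDerivAt_const_rpow hx 1).hasDerivAt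
  simp only [Real.rpow_one] at hslope
  refine (hslope.mono_left (nhdsWithin_mono _ fun q hq => ne_of_gt hq)).congr fun q => ?_
  rw [slope_def_field, tsallisIntegrand, Real.rpow_one]

end TsallisIntegrand

lemma integrable_of_tendsto_of_integral_le {α ι : Type*} [MeasurableSpace α] {ν : Measure α}
    {l : Filter ι} [l.NeBot] [l.IsCountablyGenerated] {f : ι → α → ℝ} {g : α → ℝ} {K : ℝ}
    (hf : ∀ᶠ i in l, Integrable (f i) ν ∧ 0 ≤ᵐ[ν] f i ∧ ∫ x, f i x ∂ν ≤ K)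
    (hfg : ∀ᵐ x ∂ν, Tendsto (fun i => f i x) l (𝓝 (g x))) : Integrable g ν := by
  obtain ⟨i, hi⟩ := l.exists_seq_tendsto
  obtain ⟨N, hN⟩ := eventually_atTop.1 (hi.eventually hf)
  have hiN := hi.comp (tendsto_add_atTop_nat N)
  replace hN (n : ℕ) := hN (n + N) (Nat.le_add_left N n)
  have hlim : ∀ᵐ x ∂ν, Tendsto (fun n => f (i (n + N)) x) atTop (𝓝 (g x)) := by
    filter_upwards [hfg] with x hx using hx.comp hiN
  refine ⟨aestronglyMeasurable_of_tendsto_ae _ (fun n => (hN n).1.aestronglyMeasurable) hlim, ?_⟩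
  calc ∫⁻ x, ‖g x‖ₑ ∂ν = ∫⁻ x, liminf (fun n => ‖f (i (n + N)) x‖ₑ) atTop ∂ν :=
        lintegral_congr_ae (by filter_upwards [hlim] with x hx using hx.enorm.liminf_eq.symm)
    _ ≤ liminf (fun n => ∫⁻ x, ‖f (i (n + N)) x‖ₑ ∂ν) atTop :=
        lintegral_liminf_le' fun n => (hN n).1.aemeasurable.enorm
    _ ≤ ENNReal.ofReal K := by
        refine liminf_le_of_le (by isBoundedDefault) fun b hb => ?_
        obtain ⟨n, hn⟩ := hb.exists
        refine hn.trans ?_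
        rw [← ofReal_integral_norm_eq_lintegral_enorm (hN n).1]
        refine ENNReal.ofReal_le_ofReal (le_of_eq_of_le (integral_congr_ae ?_) (hN n).2.2)
        filter_upwards [(hN n).2.1] with x hx using Real.norm_of_nonneg hx
    _ < ⊤ := ENNReal.ofReal_lt_top

section EntropyOfDensity

variable {d : ℕ} {ρ : EuclideanSpace ℝ (Fin d) → ℝ} {q : ℝ}

namespace IsProbDensity

lemma tsallisEntropy_eq (hρ : IsProbDensity ρ) (hq : q ≠ 1) (hint : Integrable fun x => ρ x ^ q) :
    tsallisEntropy q ρ = -∫ x, tsallisIntegrand q (ρ x) := by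
  simp only [tsallisEntropy, if_neg hq, tsallisIntegrand, integral_div,
    integral_sub hint hρ.integrable, hρ.integral_eq_one]
  ring

lemma integrable_rpow (hρ : IsProbDensity ρ) (hsq : Integrable fun x => ρ x ^ 2)
    (hq : q ∈ Icc 1 2) : Integrable fun x => ρ x ^ q := by
  refine (hρ.integrable.add hsq).mono'
    (hρ.integrable.aemeasurable.pow_const q).aestronglyMeasurable ?_
  filter_upwards [hρ.nonneg] with x hx
  rw [Pi.add_apply, Real.norm_of_nonneg (Real.rpow_nonneg hx q)]
  rcases le_total (ρ x) 1 with h1 | h1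
  · linarith [Real.rpow_le_self_of_le_one hx h1 hq.1, sq_nonneg (ρ x)]
  · have := Real.rpow_le_rpow_of_exponent_le h1 hq.2
    rw [Real.rpow_two] at this
    linarith

lemma integrable_tsallisIntegrand (hρ : IsProbDensity ρ) (hsq : Integrable fun x => ρ x ^ 2)
    (hq : q ∈ Icc 1 2) : Integrable fun x => tsallisIntegrand q (ρ x) :=
  ((hρ.integrable_rpow hsq hq).sub hρ.integrable).div_const _

lemma tendsto_tsallisEntropy (hρ : IsProbDensity ρ) (hsq : Integrable fun x => ρ x ^ 2)
    (hfin : TsallisFinite 1 ρ) :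
    Tendsto (fun q => tsallisEntropy q ρ) (𝓝[>] 1) (𝓝 (tsallisEntropy 1 ρ)) := by
  rw [TsallisFinite, if_pos rfl] at hfin
  rw [tsallisEntropy, if_pos rfl]
  have hmem : Ioc (1 : ℝ) 2 ∈ 𝓝[>] 1 := Ioc_mem_nhdsGT one_lt_two
  refine Tendsto.congr' (f₁ := fun q => -∫ x, tsallisIntegrand q (ρ x)) ?_
    (tendsto_integral_filter_of_dominated_convergence _ ?_ ?_ (hfin.abs.add hsq) ?_).neg
  · filter_upwards [hmem] with q hq
    exact (hρ.tsallisEntropy_eq hq.1.ne' (hρ.integrable_rpow hsq (Ioc_subset_Icc_self hq))).symm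
  · filter_upwards [hmem] with q hq
    exact (hρ.integrable_tsallisIntegrand hsq (Ioc_subset_Icc_self hq)).aestronglyMeasurable
  · filter_upwards [hmem] with q hq
    filter_upwards [hρ.nonneg] with x hx
    rw [Pi.add_apply, Real.norm_eq_abs, abs_le]
    constructor
    · linarith [mul_log_le_tsallisIntegrand hq.1 hx, sq_nonneg (ρ x),
        neg_abs_le (ρ x * Real.log (ρ x))]
    · linarith [tsallisIntegrand_le_sq hq hx, abs_nonneg (ρ x * Real.log (ρ x))]
  · filter_upwards [hρ.nonneg] with x hx using tendsto_tsallisIntegrand hx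

lemma tsallisFinite_one_of_le (hρ : IsProbDensity ρ) (hsq : Integrable fun x => ρ x ^ 2) {K : ℝ}
    (hK : ∀ᶠ q in 𝓝[>] 1, tsallisEntropy q ρ ≤ K) : TsallisFinite 1 ρ := by
  rw [TsallisFinite, if_pos rfl]
  have hlim : Integrable fun x => ρ x ^ 2 - ρ x * Real.log (ρ x) := by
    refine integrable_of_tendsto_of_integral_le (K := (∫ x, ρ x ^ 2) + K) (l := 𝓝[>] (1 : ℝ))
      (f := fun q x => ρ x ^ 2 - tsallisIntegrand q (ρ x)) ?_ ?_
    · filter_upwards [hK, Ioc_mem_nhdsGT one_lt_two] with q hqK hq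
      have hint := hρ.integrable_tsallisIntegrand hsq (Ioc_subset_Icc_self hq)
      rw [hρ.tsallisEntropy_eq hq.1.ne' (hρ.integrable_rpow hsq (Ioc_subset_Icc_self hq))] at hqK
      refine ⟨hsq.sub hint, ?_, by rw [integral_sub hsq hint]; linarith⟩
      filter_upwards [hρ.nonneg] with x hx using sub_nonneg.2 (tsallisIntegrand_le_sq hq hx)
    · filter_upwards [hρ.nonneg] with x hx using (tendsto_tsallisIntegrand hx).const_sub _
  simpa only [Pi.sub_def, sub_sub_cancel] using hsq.sub hlim

lemma shannonEntropyEqTop (hρ : IsProbDensity ρ) (hsq : Integrable fun x => ρ x ^ 2)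
    (hfin : ¬TsallisFinite 1 ρ) : ShannonEntropyEqTop ρ := by
  rw [TsallisFinite, if_pos rfl] at hfin
  have hle : ∀ᵐ x, ρ x * Real.log (ρ x) ≤ ρ x ^ 2 := by
    filter_upwards [hρ.nonneg] with x hx
    exact (mul_log_le_tsallisIntegrand one_lt_two hx).trans
      (tsallisIntegrand_le_sq (by norm_num) hx)
  refine ⟨?_, (lintegral_mono_ae (hle.mono fun _ => ENNReal.ofReal_le_ofReal)).trans_lt
    hsq.lintegral_lt_top⟩
  by_contra hneg
  have hmeas : AEStronglyMeasurable fun x => ρ x * Real.log (ρ x) :=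
    (hρ.integrable.aemeasurable.mul hρ.integrable.aemeasurable.log).aestronglyMeasurable
  have hdiff : Integrable fun x => ρ x ^ 2 - ρ x * Real.log (ρ x) := by
    refine (lintegral_ofReal_ne_top_iff_integrable (hsq.aestronglyMeasurable.sub hmeas) ?_).1 ?_
    · filter_upwards [hle] with x hx using sub_nonneg.2 hx
    · refine ((lintegral_mono fun x => ?_).trans_lt
        ((lintegral_add_left' hsq.aemeasurable.ennreal_ofReal _).trans_lt
          (ENNReal.add_lt_top.2 ⟨hsq.lintegral_lt_top, Ne.lt_top hneg⟩))).ne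
      rw [sub_eq_add_neg]
      exact ENNReal.ofReal_add_le
  exact hfin (by simpa only [Pi.sub_def, sub_sub_cancel] using hsq.sub hdiff)

end IsProbDensity

end EntropyOfDensity

section EntropyOfFlow

variable {d : ℕ} (μ : Measure (EuclideanSpace ℝ (Fin d)))

section FiniteMeasure

variable [IsFiniteMeasure μ] [NeZero μ] {q t : ℝ}

lemma integrable_measureHeatFlow_rpow (hq : 1 ≤ q) (ht : 0 < t) :
    Integrable fun x => measureHeatFlow μ t x ^ q := by
  simpa only [mul_one] using (HasHeatMoments.const (μ := μ) 1).integrable_rpow_mul hq ht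

lemma integrable_measureHeatFlow_sq (ht : 0 < t) :
    Integrable fun x => measureHeatFlow μ t x ^ 2 := by
  simpa only [Real.rpow_two] using integrable_measureHeatFlow_rpow μ one_le_two ht

lemma continuousOn_fisherInfo (hq : 1 ≤ q) : ContinuousOn (fisherInfo μ q) (Ioi 0) :=
  fun _ ht => (hasDerivAt_fisherInfo hq ht).continuousAt.continuousWithinAt

lemma tendsto_fisherInfo (ht : 0 < t) :
    Tendsto (fun q => fisherInfo μ q t) (𝓝[>] 1) (𝓝 (fisherInfo μ 1 t)) := by
  obtain ⟨B, hB, hle⟩ :=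
    (hasHeatMoments_sum_logGrad_sq (μ := μ)).exists_abs_rpow_mul_le ht le_rfl 2
  refine tendsto_integral_filter_of_dominated_convergence B (.of_forall fun q =>
    (hasHeatMoments_sum_logGrad_sq.continuous_rpow_mul q ht).aestronglyMeasurable) ?_ hB
    (ae_of_all _ fun x => ?_)
  · filter_upwards [Ioc_mem_nhdsGT one_lt_two] with q hq
    exact ae_of_all _ (hle t (by simp) q (Ioc_subset_Icc_self hq))
  · exact ((Real.continuous_const_rpow (measureHeatFlow_pos μ ht x).ne').tendsto 1).mono_left
      nhdsWithin_le_nhds |>.mul_const _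

lemma tendsto_intervalIntegral_fisherInfo {s : ℝ} (hs : 0 < s) (ht : 0 < t) :
    Tendsto (fun q => ∫ τ in s..t, q * fisherInfo μ q τ) (𝓝[>] 1)
      (𝓝 (∫ τ in s..t, fisherInfo μ 1 τ)) := by
  have hpos : ∀ τ ∈ uIcc s t, 0 < τ := fun τ hτ => (lt_min hs ht).trans_le hτ.1
  obtain ⟨B, hB, hle⟩ := (hasHeatMoments_sum_logGrad_sq (μ := μ)).exists_abs_rpow_mul_le
    (lt_min hs ht) min_le_max 2
  have hmem : Ioc (1 : ℝ) 2 ∈ 𝓝[>] 1 := Ioc_mem_nhdsGT one_lt_two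
  refine intervalIntegral.tendsto_integral_filter_of_dominated_convergence
    (fun _ => 2 * ∫ x, B x) ?_ ?_ intervalIntegrable_const (ae_of_all _ fun τ hτ => ?_)
  · filter_upwards [hmem] with q hq
    exact (((continuousOn_fisherInfo μ hq.1.le).mono hpos).intervalIntegrable.const_mul q
      ).def'.aestronglyMeasurable
  · filter_upwards [hmem] with q hq
    refine ae_of_all _ fun τ hτ => ?_
    rw [norm_mul, Real.norm_of_nonneg (zero_le_one.trans hq.1.le)]
    exact mul_le_mul hq.2 (norm_integral_le_of_norm_le hB (ae_of_all _
      (hle τ (uIoc_subset_uIcc hτ) q (Ioc_subset_Icc_self hq)))) (norm_nonneg _) zero_le_two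
  · simpa only [one_mul, id_eq] using (tendsto_nhdsWithin_of_tendsto_nhds tendsto_id).mul
      (tendsto_fisherInfo μ (hpos τ (uIoc_subset_uIcc hτ)))

end FiniteMeasure

variable [IsProbabilityMeasure μ] {q t : ℝ}

lemma isProbDensity_measureHeatFlow (ht : 0 < t) : IsProbDensity (measureHeatFlow μ t) where
  nonneg := ae_of_all _ fun x => (measureHeatFlow_pos μ ht x).le
  integrable := integrable_measureHeatFlow μ ht
  integral_eq_one := by rw [integral_measureHeatFlow μ ht, probReal_univ]

lemma hasDerivAt_tsallisEntropy_of_one_lt (hq : 1 < q) (ht : 0 < t) :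
    HasDerivAt (fun t => tsallisEntropy q (measureHeatFlow μ t)) (q * fisherInfo μ q t) t := by
  simp only [tsallisEntropy, if_neg hq.ne']
  refine (((hasDerivAt_integral_rpow μ hq.le ht).const_sub 1).div_const (q - 1)).congr_deriv ?_
  have : q - 1 ≠ 0 := sub_ne_zero.2 hq.ne'
  field_simp

lemma tendsto_tsallisEntropy_measureHeatFlow {s : ℝ} (hs : 0 < s) (ht : 0 < t)
    (hfin : TsallisFinite 1 (measureHeatFlow μ s)) :
    Tendsto (fun q => tsallisEntropy q (measureHeatFlow μ t)) (𝓝[>] 1)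
      (𝓝 (tsallisEntropy 1 (measureHeatFlow μ s) + ∫ τ in s..t, fisherInfo μ 1 τ)) := by
  have hpos : uIcc s t ⊆ Ioi 0 := fun τ hτ => (lt_min hs ht).trans_le hτ.1
  refine (((isProbDensity_measureHeatFlow μ hs).tendsto_tsallisEntropy
    (integrable_measureHeatFlow_sq μ hs) hfin).add
    (tendsto_intervalIntegral_fisherInfo μ hs ht)).congr' ?_
  filter_upwards [self_mem_nhdsWithin] with q hq
  rw [intervalIntegral.integral_eq_sub_of_hasDerivAt
    (fun τ hτ => hasDerivAt_tsallisEntropy_of_one_lt μ hq (hpos hτ))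
    (((continuousOn_fisherInfo μ (le_of_lt hq)).mono hpos).intervalIntegrable.const_mul q),
    add_sub_cancel]

lemma tsallisFinite_one_measureHeatFlow {s : ℝ} (hs : 0 < s) (ht : 0 < t)
    (hfin : TsallisFinite 1 (measureHeatFlow μ s)) : TsallisFinite 1 (measureHeatFlow μ t) :=
  (isProbDensity_measureHeatFlow μ ht).tsallisFinite_one_of_le (integrable_measureHeatFlow_sq μ ht)
    ((tendsto_tsallisEntropy_measureHeatFlow μ hs ht hfin).eventually_le_const (lt_add_one _))

lemma hasDerivAt_tsallisEntropy_one (hfin : ∀ t, 0 < t → TsallisFinite 1 (measureHeatFlow μ t))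
    (ht : 0 < t) :
    HasDerivAt (fun t => tsallisEntropy 1 (measureHeatFlow μ t)) (fisherInfo μ 1 t) t := by
  have hcont := continuousOn_fisherInfo μ le_rfl
  refine ((intervalIntegral.integral_hasDerivAt_right IntervalIntegrable.refl
    (hcont.stronglyMeasurableAtFilter isOpen_Ioi t ht)
    (hcont.continuousAt (Ioi_mem_nhds ht))).const_add
      (tsallisEntropy 1 (measureHeatFlow μ t))).congr_of_eventuallyEq ?_
  filter_upwards [Ioi_mem_nhds ht] with s hs
  exact tendsto_nhds_unique ((isProbDensity_measureHeatFlow μ hs).tendsto_tsallisEntropy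
    (integrable_measureHeatFlow_sq μ hs) (hfin s hs))
    (tendsto_tsallisEntropy_measureHeatFlow μ ht hs (hfin t ht))

lemma hasDerivAt_tsallisEntropy (hq : 1 ≤ q)
    (hfin : ∀ t, 0 < t → TsallisFinite q (measureHeatFlow μ t)) (ht : 0 < t) :
    HasDerivAt (fun t => tsallisEntropy q (measureHeatFlow μ t)) (q * fisherInfo μ q t) t := by
  rcases hq.eq_or_lt with rfl | hq
  · rw [one_mul]
    exact hasDerivAt_tsallisEntropy_one μ hfin ht
  · exact hasDerivAt_tsallisEntropy_of_one_lt μ hq ht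

lemma tsallisFinite_or_shannonEntropyEqTop (hq : 1 ≤ q) :
    (∀ t, 0 < t → TsallisFinite q (measureHeatFlow μ t)) ∨
      (q = 1 ∧ ∀ t, 0 < t → ShannonEntropyEqTop (measureHeatFlow μ t)) := by
  rcases hq.eq_or_lt with rfl | hq
  · by_cases hfin : ∃ s, 0 < s ∧ TsallisFinite 1 (measureHeatFlow μ s)
    · obtain ⟨s, hs, hfin⟩ := hfin
      exact .inl fun t ht => tsallisFinite_one_measureHeatFlow μ hs ht hfin
    · push Not at hfin
      exact .inr ⟨rfl, fun t ht => (isProbDensity_measureHeatFlow μ ht).shannonEntropyEqTop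
        (integrable_measureHeatFlow_sq μ ht) (hfin t ht)⟩
  · refine .inl fun t ht => ?_
    rw [TsallisFinite, if_neg hq.ne']
    exact integrable_measureHeatFlow_rpow μ hq.le ht

end EntropyOfFlow

section DensityMeasure

variable {d : ℕ} {φ : EuclideanSpace ℝ (Fin d) → ℝ}

/-- The measure `φ dx`, through which the heat flow of a density is that of a measure. -/
def densityMeasure (φ : EuclideanSpace ℝ (Fin d) → ℝ) : Measure (EuclideanSpace ℝ (Fin d)) :=
  volume.withDensity fun x => ENNReal.ofReal (φ x)

lemma IsProbDensity.isProbabilityMeasure (hφ : IsProbDensity φ) :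
    IsProbabilityMeasure (densityMeasure φ) := by
  constructor
  rw [densityMeasure, withDensity_apply _ MeasurableSet.univ, Measure.restrict_univ,
    ← ofReal_integral_eq_lintegral_ofReal hφ.integrable hφ.nonneg, hφ.integral_eq_one,
    ENNReal.ofReal_one]

lemma IsProbDensity.heatFlow_eq (hφ : IsProbDensity φ) :
    heatFlow φ = measureHeatFlow (densityMeasure φ) := by
  funext t x
  rw [heatFlow, convolution, measureHeatFlow, densityMeasure,
    integral_withDensity_eq_integral_toReal_smul₀ hφ.integrable.aemeasurable.ennreal_ofReal
      (ae_of_all _ fun _ => ENNReal.ofReal_lt_top)]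
  refine integral_congr_ae ?_
  filter_upwards [hφ.nonneg] with y hy
  rw [ENNReal.toReal_ofReal hy, smul_eq_mul, ContinuousLinearMap.mul_apply']

end DensityMeasure

lemma concaveOn_and_deriv_deriv_nonpos {s : Set ℝ} (hconv : Convex ℝ s) (hs : IsOpen s)
    {f f' f'' : ℝ → ℝ} (hf : ∀ t ∈ s, HasDerivAt f (f' t) t)
    (hf' : ∀ t ∈ s, HasDerivAt f' (f'' t) t) (hf'' : ∀ t ∈ s, f'' t ≤ 0) :
    ConcaveOn ℝ s f ∧ ∀ t ∈ s,
      DifferentiableAt ℝ f t ∧ DifferentiableAt ℝ (deriv f) t ∧ deriv (deriv f) t ≤ 0 := by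
  have hderiv (t : ℝ) (ht : t ∈ s) : HasDerivAt (deriv f) (f'' t) t := by
    refine (hf' t ht).congr_of_eventuallyEq ?_
    filter_upwards [hs.mem_nhds ht] with u hu using (hf u hu).deriv
  have hneg (t : ℝ) (ht : t ∈ s) : deriv (deriv f) t ≤ 0 := (hderiv t ht).deriv.trans_le (hf'' t ht)
  exact ⟨concaveOn_of_deriv2_nonpos' hconv
    (fun t ht => (hf t ht).differentiableAt.differentiableWithinAt)
    (fun t ht => (hderiv t ht).differentiableAt.differentiableWithinAt) hneg,
    fun t ht => ⟨(hf t ht).differentiableAt, (hderiv t ht).differentiableAt, hneg t ht⟩⟩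

theorem theorem1_general {d : ℕ} {q : ℝ}
    (hq : (d = 1 ∧ q ∈ Icc (1 : ℝ) 3) ∨
      (1 < d ∧ q ∈ Icc (1 : ℝ) (2 * (Real.sqrt 5 + 1) / Real.sqrt 5)))
    (μ : Measure (EuclideanSpace ℝ (Fin d))) [IsProbabilityMeasure μ] :
    ((∀ t : ℝ, 0 < t → TsallisFinite q (measureHeatFlow μ t)) ∧
      ConcaveOn ℝ (Ioi (0 : ℝ)) (fun t => tsallisEntropy q (measureHeatFlow μ t)) ∧
      ∀ t : ℝ, 0 < t →
        DifferentiableAt ℝ (fun s => tsallisEntropy q (measureHeatFlow μ s)) t ∧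
        DifferentiableAt ℝ (deriv (fun s => tsallisEntropy q (measureHeatFlow μ s))) t ∧
        deriv (deriv (fun s => tsallisEntropy q (measureHeatFlow μ s))) t ≤ 0) ∨
    (q = 1 ∧ ∀ t : ℝ, 0 < t → ShannonEntropyEqTop (measureHeatFlow μ t)) := by
  have hq1 : 1 ≤ q := hq.elim (fun h => h.2.1) fun h => h.2.1
  obtain ⟨l, β, γ, hlβ, hnonneg⟩ := exists_dissipationForm_nonneg hq
  refine (tsallisFinite_or_shannonEntropyEqTop μ hq1).imp_left fun hfin => ⟨hfin,
    concaveOn_and_deriv_deriv_nonpos (convex_Ioi 0) isOpen_Ioi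
      (fun t ht => hasDerivAt_tsallisEntropy μ hq1 hfin ht)
      (fun t ht => (hasDerivAt_fisherInfo_dissipationForm hq1 ht hlβ γ).const_mul q)
      fun t ht => mul_nonpos_of_nonneg_of_nonpos (zero_le_one.trans hq1) (neg_nonpos.2 ?_)⟩
  exact integral_nonneg fun x =>
    mul_nonneg (Real.rpow_nonneg (measureHeatFlow_pos μ ht x).le q) (hnonneg _ _)

end

theorem theorem1 (d : ℕ) (q : ℝ)
    (hq : (d = 1 ∧ q ∈ Icc (1 : ℝ) 3) ∨
      (1 < d ∧ q ∈ Icc (1 : ℝ) (2 * (Real.sqrt 5 + 1) / Real.sqrt 5)))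
    (φ₀ : EuclideanSpace ℝ (Fin d) → ℝ) (hφ₀ : IsProbDensity φ₀) :
    ((∀ t : ℝ, 0 < t → TsallisFinite q (heatFlow φ₀ t)) ∧
      ConcaveOn ℝ (Ioi (0 : ℝ)) (fun t => tsallisEntropy q (heatFlow φ₀ t)) ∧
      ∀ t : ℝ, 0 < t →
        DifferentiableAt ℝ (fun s => tsallisEntropy q (heatFlow φ₀ s)) t ∧
        DifferentiableAt ℝ (deriv (fun s => tsallisEntropy q (heatFlow φ₀ s))) t ∧
        deriv (deriv (fun s => tsallisEntropy q (heatFlow φ₀ s))) t ≤ 0) ∨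
    (q = 1 ∧ ∀ t : ℝ, 0 < t → ShannonEntropyEqTop (heatFlow φ₀ t)) := by
  have := hφ₀.isProbabilityMeasure
  simpa only [hφ₀.heatFlow_eq] using theorem1_general hq (densityMeasure φ₀)
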